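/- Let $z>0$. Let $X$ be the symmetric random walk on $\mathbb Z$ started from $0$ with jumps $\pm1$, each of probability $\frac{z^2}{2+2z^2}$, and $\pm2$, each of probability $\frac1{2+2z^2}$. For $k\in\mathbb Z$ let $\alpha_k=\sum_{n\ge0}\big(\mathbb P(X_n=0)-\mathbb P(X_n=k)\big)$ and $$q_k=\frac{z^2}{2+2z^2}(-1)^{k+1}\big(2\alpha_k-\alpha_{k+1}-\alpha_{k-1}\big)$$ (these weights are nonnegative and sum to $1$). Let $\Gamma$ be the weighted graph with vertex set $\mathbb Z\times2\mathbb Z$, symmetric with respect to the real line $\mathbb Z\times\{0\}$, with the following conductances: any two points that differ by $\pm(0,2)$, and any two points off the real line that differ by $\pm(2,0)$, are joined by an edge of conductance $1$; points $u$ and $u+k$ of the real line are joined with conductance $\lambda\,(\mathbf 1_{\{|k|=2\}}+q_k)$ (including a loop for $k=0$); there are no other edges. Here $\lambda>0$ is the multiplicity given in the symmetrised graph to the edges on the real line. (For $\lambda=2$, folding the walk along the real line gives the odd effective walk of the free boundary dimer model with monomer weight $z$ in the half-plane. For $\lambda=2/3$ all vertices have the same total conductance, and each step is made horizontally with probability $1/2$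 and vertically with probability $1/2$, where a loop counts as a horizontal step.) Let $P$ be the transition matrix of the random walk on $\Gamma$, which jumps along edges with probability proportional to the conductances, let $\tilde P=(I+P)/2$, and let $\tilde p_t(x,y)=\tilde P^t(x,y)$. The potential kernel of the lazy walk is $$\tilde a(x,o)=-\sum_{t\ge0}\big(\tilde p_t(x,o)-\tilde p_t(o,o)\big).$$ Say that two vertices are of the same class if their horizontal coordinates have the same parity, and let $\mathrm{dist}$ be the $\ell^1$ distance on $\mathbb Z^2$. Then for all $z>0$, $\lambda>0$ and $c>6$ there is a constant $C=C(z,\lambda,c)>0$ such that, for all vertices $o,x,x'$ of $\Gamma$ with $x,x'$ of the same class, $\mathrm{dist}(x,x')=2$ and $R:=\mathrm{dist}(o,x)\ge2$, the series $\sum_{t\ge0}\big(\tilde p_t(x,o)-\tilde p_t(x',o)\big)$ converges absolutely, its sum is $-\big(\tilde a(x,o)-\tilde a(x',o)\big)$, and $$|\tilde a(x,o)-\tilde a(x',o)|\le C\,\frac{(\log R)^c}{R}.$$ -/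

import Mathlib

noncomputable section

namespace EffectiveWalk

/-! ### The auxiliary one-dimensional walk and its potential kernel -/

/-- `auxProb z n k = ℙ₀(X_n = k)` for the symmetric walk `X` on `ℤ` with jumps `±1`, each of
probability `z² / (2 + 2 z²)`, and `±2`, each of probability `1 / (2 + 2 z²)`. -/
def auxProb (z : ℝ) : ℕ → ℤ → ℝ
  | 0, k => if k = 0 then 1 else 0
  | n + 1, k =>
      z ^ 2 / (2 + 2 * z ^ 2) * (auxProb z n (k - 1) + auxProb z n (k + 1))
        + 1 / (2 + 2 * z ^ 2) * (auxProb z n (k - 2) + auxProb z n (k + 2))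

/-- The potential kernel `α_k = ∑_n (ℙ₀(X_n = 0) - ℙ₀(X_n = k))` of the auxiliary walk. -/
def auxPotential (z : ℝ) (k : ℤ) : ℝ :=
  ∑' n : ℕ, (auxProb z n 0 - auxProb z n k)

/-- The effective weight `q_k` of a step by `k` along the bottom row:
`q_k = z² / (2 + 2 z²) * (-1)^(k+1) * (2 α_k - α_{k+1} - α_{k-1})`. -/
def effWeight (z : ℝ) (k : ℤ) : ℝ :=
  z ^ 2 / (2 + 2 * z ^ 2) * (-1) ^ (k + 1) *
    (2 * auxPotential z k - auxPotential z (k + 1) - auxPotential z (k - 1))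

/-! ### The symmetrised weighted graph `Γ` -/

/-- A vertex of the symmetrised graph, whose vertex set is `ℤ × 2ℤ`:
the pair `(u, m)` stands for the lattice point with coordinates `(u, 2 m)`. -/
abbrev Vertex : Type := ℤ × ℤ

/-- The `ℓ¹` distance in `ℤ²` between the lattice points `(x.1, 2 x.2)` and `(y.1, 2 y.2)`. -/
def dist (x y : Vertex) : ℕ := (x.1 - y.1).natAbs + 2 * (x.2 - y.2).natAbs

/-- Two vertices have the same class when both lie in `(2ℤ) × (2ℤ)` or both in
`(2ℤ + 1) × (2ℤ)`. -/
def SameClass (x y : Vertex) : Prop := Even (x.1 - y.1)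

/-- Conductances of the symmetrised graph of the odd effective walk.
All edges of the two sublattices of mesh two off the real line have conductance `1`.
On the real line the half-plane graph has conductance `1_{|k| = 2} + q_k` between points whose
difference is `k`; since these edges lie both in the half-plane graph and in its mirror image,
they enter with a multiplicity `lam`. For `lam = 2` (both copies are counted) folding the walk
along the real line gives back the half-plane effective walk; for `lam = 2 / 3` all vertices have
the same total conductance, so a step from the real line is horizontal with probability `1/2`. -/
def conductance (z lam : ℝ) (x y : Vertex) : ℝ :=
  if x.1 = y.1 ∧ (x.2 - y.2).natAbs = 1 then 1
  else if x.2 = y.2 then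
    if x.2 = 0 then
      lam * ((if (x.1 - y.1).natAbs = 2 then 1 else 0) + effWeight z (y.1 - x.1))
    else if (x.1 - y.1).natAbs = 2 then 1 else 0
  else 0

/-! ### The random walk, its lazy version, and the potential kernel -/

/-- Transition matrix `P` of the random walk on the weighted graph. -/
def step (z lam : ℝ) (x y : Vertex) : ℝ :=
  conductance z lam x y / ∑' w : Vertex, conductance z lam x w

/-- Transition matrix `(I + P) / 2` of the lazy walk. -/
def lazyStep (z lam : ℝ) (x y : Vertex) : ℝ :=
  ((if x = y then 1 else 0) + step z lam x y) / 2

/-- The `t`-step transition probabilities of the lazy walk. -/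
def lazyProb (z lam : ℝ) : ℕ → Vertex → Vertex → ℝ
  | 0, x, y => if x = y then 1 else 0
  | t + 1, x, y => ∑' w : Vertex, lazyStep z lam x w * lazyProb z lam t w y

/-- The potential kernel of the lazy walk, normalised to vanish at `(o, o)`. -/
def potentialKernel (z lam : ℝ) (x o : Vertex) : ℝ :=
  -∑' t : ℕ, (lazyProb z lam t x o - lazyProb z lam t o o)

end EffectiveWalk

end

namespace EffectiveWalk

open Filter Topology MeasureTheory

/-! ### Lazy nearest-neighbour kernels on `ℤ` with killing -/

/-! The graph is invariant under horizontal translations, so a cosine transform in the horizontal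
coordinate turns the lazy walk, at each frequency θ in (0, π), into a killed nearest-neighbour chain
on the rows (`lazyProb_eq`). The infinite-range jumps cause no trouble: the weights q are a
symmetric geometric law (`effWeight_eq`), whose transform is rational in cos θ. The killing is 4
sin² θ in every row except row 0, so the Green function of the chain is explicit
(`hasSum_rowKernel_green`): up to a constant it is (s^|m-n| - V s^(|m|+|n|)) / w, with s = `decay
θ`, V = `refl z lam θ` and the Wronskian w = 4 sin θ √(1 + sin² θ).

The Wronskian vanishes at 0 and at π, and a step inside a class cancels exactly these zeros: a
horizontal step by 2 produces a factor sin θ, a vertical step a factor 1 - s. What remains are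
integrals of cos (aθ) or sin (aθ) against s^M g, with g of class C¹ up to the endpoints. Since s ≤
exp (-sin θ), the integral of s^M is O(1/(M+1)); one integration by parts gives O(1/|a|) uniformly
in M (`exists_oscillatory_bound`). Hence the gradient is O(1/R) without any logarithm
(`exists_gradient_bound`), and for R ≥ 2 the power of the logarithm only changes the constant.

Summing over time under the integral needs a majorant. For horizontal differences it is the
nonnegative kernel itself. For vertical ones, laziness makes the powers of the chain positive
semidefinite, and Cauchy-Schwarz (`abs_rowKernel_sub_le`), balanced by √(sin θ), gives an integrable
bound. Unit steps along the bottom row link the two classes, so every series defining the potential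
kernel converges. -/

/-- The operator `f ↦ f - (2 W)⁻¹ ((2 + e) f - f(· + 1) - f(· - 1))`. -/
noncomputable def rowOp (W e : ℤ → ℝ) (f : ℤ → ℝ) (m : ℤ) : ℝ :=
  ((2 * W m - 2 - e m) * f m + (f (m + 1) + f (m - 1))) / (2 * W m)

/-- The powers of `rowOp` applied to the indicator of `n`, evaluated at `m`. -/
noncomputable def rowKernel (W e : ℤ → ℝ) (t : ℕ) (m n : ℤ) : ℝ :=
  (rowOp W e)^[t] (Pi.single n 1) m

theorem rowKernel_zero (W e : ℤ → ℝ) (m n : ℤ) :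
    rowKernel W e 0 m n = if m = n then 1 else 0 := by
  simp [rowKernel, Pi.single_apply]

theorem rowKernel_succ (W e : ℤ → ℝ) (t : ℕ) (m n : ℤ) :
    rowKernel W e (t + 1) m n = rowOp W e (fun l => rowKernel W e t l n) m := by
  simp only [rowKernel, Function.iterate_succ_apply']

theorem rowOp_add (W e f g : ℤ → ℝ) : rowOp W e (f + g) = rowOp W e f + rowOp W e g := by
  ext m; simp only [rowOp, Pi.add_apply]; ring

theorem rowOp_smul (W e : ℤ → ℝ) (a : ℝ) (f : ℤ → ℝ) :
    rowOp W e (a • f) = a • rowOp W e f := by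
  ext m; simp only [rowOp, Pi.smul_apply, smul_eq_mul]; ring

theorem iterate_rowOp_add (W e : ℤ → ℝ) (t : ℕ) (f g : ℤ → ℝ) :
    (rowOp W e)^[t] (f + g) = (rowOp W e)^[t] f + (rowOp W e)^[t] g := by
  induction t generalizing f g with
  | zero => rfl
  | succ t ih => simp only [Function.iterate_succ_apply, rowOp_add, ih]

theorem iterate_rowOp_smul (W e : ℤ → ℝ) (t : ℕ) (a : ℝ) (f : ℤ → ℝ) :
    (rowOp W e)^[t] (a • f) = a • (rowOp W e)^[t] f := by
  induction t generalizing f with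
  | zero => rfl
  | succ t ih => simp only [Function.iterate_succ_apply, rowOp_smul, ih]

section kernel

variable {W e : ℤ → ℝ}

/-- The condition `e m + 4 ≤ 2 * W m` makes the diagonal coefficient at least the sum of the two
off-diagonal ones. Only its sign matters here; its size matters in `pairing_rowOp_self_nonneg`. -/
theorem rowKernel_nonneg (hW : ∀ m, 0 < W m) (he : ∀ m, e m + 4 ≤ 2 * W m) (t : ℕ) (m n : ℤ) :
    0 ≤ rowKernel W e t m n := by
  induction t generalizing m with
  | zero => rw [rowKernel_zero]; split_ifs <;> norm_num
  | succ t ih =>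
    rw [rowKernel_succ, rowOp]
    have h1 := hW m
    have h2 : 0 ≤ 2 * W m - 2 - e m := by linarith [he m]
    have h3 := ih m
    have h4 := ih (m + 1)
    have h5 := ih (m - 1)
    positivity

/-- The coefficients are nonnegative with row sum 1 - e / (2 W), so killing contracts the sup norm.
-/
theorem abs_rowOp_le {δ B : ℝ} {f : ℤ → ℝ} (hW : ∀ m, 0 < W m) (he : ∀ m, e m + 4 ≤ 2 * W m)
    (hδ : ∀ m, 2 * W m * δ ≤ e m) (hf : ∀ m, |f m| ≤ B) (m : ℤ) :
    |rowOp W e f m| ≤ (1 - δ) * B := by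
  have h1 := hW m
  have h2 : 0 ≤ 2 * W m - 2 - e m := by linarith [he m]
  have hB : 0 ≤ B := (abs_nonneg _).trans (hf 0)
  rw [rowOp, abs_div, abs_of_pos (by positivity : (0 : ℝ) < 2 * W m), div_le_iff₀ (by positivity)]
  calc |(2 * W m - 2 - e m) * f m + (f (m + 1) + f (m - 1))|
      ≤ |(2 * W m - 2 - e m) * f m| + (|f (m + 1)| + |f (m - 1)|) :=
        (abs_add_le _ _).trans (add_le_add le_rfl (abs_add_le _ _))
    _ ≤ (2 * W m - 2 - e m) * B + (B + B) := by
        rw [abs_mul, abs_of_nonneg h2]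
        gcongr <;> apply hf
    _ ≤ (1 - δ) * B * (2 * W m) := by nlinarith [mul_le_mul_of_nonneg_right (hδ m) hB]

/-- A bounded solution of the Green equation is the sum of the powers of the kernel. -/
theorem hasSum_rowKernel {δ B : ℝ} {n : ℤ} {g : ℤ → ℝ} (hW : ∀ m, 0 < W m)
    (he : ∀ m, e m + 4 ≤ 2 * W m) (hδ : ∀ m, 2 * W m * δ ≤ e m) (hδ0 : 0 < δ)
    (hg : ∀ m, |g m| ≤ B)
    (hgreen : ∀ m, (2 + e m) * g m - (g (m + 1) + g (m - 1)) = if m = n then 2 * W m else 0)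
    (m : ℤ) : HasSum (fun t => rowKernel W e t m n) (g m) := by
  rw [hasSum_iff_tendsto_nat_of_nonneg (fun t => rowKernel_nonneg hW he t m n)]
  have hδ1 : δ ≤ 1 := by
    have h1 := hW 0
    have h2 := hδ 0
    have h3 := he 0
    by_contra h
    push Not at h
    nlinarith
  -- Writing T for the operator, the Green equation says T g = g - δ_n.
  have hop : ∀ m, rowOp W e g m = g m - if m = n then 1 else 0 := by
    intro m
    have h1 := hW m
    have h2 := hgreen m
    rw [rowOp, div_eq_iff (by positivity)]
    split_ifs at h2 ⊢ <;> linarith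
  -- By `hop` the remainder after N terms is T^N g, and each application of T costs a factor 1 - δ.
  have key : ∀ N m, |g m - ∑ t ∈ Finset.range N, rowKernel W e t m n| ≤ (1 - δ) ^ N * B := by
    intro N
    induction N with
    | zero => simpa using hg
    | succ N ih =>
      intro m
      have h := abs_rowOp_le hW he hδ ih m
      have h2 : rowOp W e (fun m => g m - ∑ t ∈ Finset.range N, rowKernel W e t m n) m
          = g m - ∑ t ∈ Finset.range (N + 1), rowKernel W e t m n := by
        rw [Finset.sum_range_succ', rowKernel_zero]
        have h3 : ∑ t ∈ Finset.range N, rowKernel W e (t + 1) m n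
            = rowOp W e (fun m => ∑ t ∈ Finset.range N, rowKernel W e t m n) m := by
          simp only [rowKernel_succ, rowOp, ← Finset.sum_div, Finset.sum_add_distrib,
            ← Finset.mul_sum]
        have h4 := hop m
        rw [h3]
        simp only [rowOp] at h4 ⊢
        have h1 := (hW m).ne'
        field_simp at h4 ⊢
        linarith
      rw [h2] at h
      rw [pow_succ']
      linarith
  have hlim : Tendsto (fun N : ℕ => (1 - δ) ^ N * B) atTop (𝓝 0) := by
    simpa using (tendsto_pow_atTop_nhds_zero_of_lt_one (by linarith) (by linarith)).mul_const B
  have := squeeze_zero_norm (fun N => (Real.norm_eq_abs _).trans_le (key N m)) hlim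
  have h2 := (tendsto_const_nhds (x := g m)).sub this
  simpa using h2

/-! ### Positivity of the quadratic form -/

/-- The pairing of two functions on `ℤ` weighted by `W`. -/
noncomputable def pairing (W f g : ℤ → ℝ) : ℝ := ∑' m, W m * f m * g m

theorem rowOp_support_finite {f : ℤ → ℝ} (hf : f.support.Finite) :
    (rowOp W e f).support.Finite := by
  refine ((hf.union (hf.image (· - 1))).union (hf.image (· + 1))).subset ?_
  intro m hm
  by_contra hc
  simp only [Set.mem_union, Function.mem_support, Set.mem_image, not_or, not_exists, not_and,
    not_not] at hc
  obtain ⟨⟨h1, h2⟩, h3⟩ := hc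
  apply hm
  have h4 : f (m + 1) = 0 := by
    by_contra h; exact h2 (m + 1) h (by ring)
  have h5 : f (m - 1) = 0 := by
    by_contra h; exact h3 (m - 1) h (by ring)
  simp [rowOp, h1, h4, h5]

theorem iterate_rowOp_support_finite {f : ℤ → ℝ} (hf : f.support.Finite) (t : ℕ) :
    ((rowOp W e)^[t] f).support.Finite := by
  induction t with
  | zero => exact hf
  | succ t ih => rw [Function.iterate_succ_apply']; exact rowOp_support_finite ih

theorem summable_mul_of_support_finite {f : ℤ → ℝ} (hf : f.support.Finite) (g : ℤ → ℝ) :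
    Summable (fun m => f m * g m) :=
  summable_of_hasFiniteSupport (hf.subset fun m hm => by
    simp only [Function.mem_support] at hm ⊢
    exact left_ne_zero_of_mul hm)

theorem pairing_rowOp {f g : ℤ → ℝ} (hW : ∀ m, 0 < W m) (hf : f.support.Finite) :
    pairing W f (rowOp W e g)
      = (∑' m, f m * ((2 * W m - 2 - e m) / 2 * g m)) + (∑' m, f m * (g (m + 1) / 2))
        + ∑' m, f m * (g (m - 1) / 2) := by
  rw [← (summable_mul_of_support_finite hf _).tsum_add (summable_mul_of_support_finite hf _),
    ← ((summable_mul_of_support_finite hf _).add (summable_mul_of_support_finite hf _)).tsum_add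
      (summable_mul_of_support_finite hf _)]
  refine tsum_congr fun m => ?_
  have := (hW m).ne'
  simp only [rowOp]
  field_simp
  ring

/-- Multiplied by `W`, the operator has a symmetric matrix: both off-diagonal entries are 1/2. -/
theorem pairing_rowOp_comm {f g : ℤ → ℝ} (hW : ∀ m, 0 < W m) (hf : f.support.Finite)
    (hg : g.support.Finite) : pairing W f (rowOp W e g) = pairing W (rowOp W e f) g := by
  have hsymm : pairing W (rowOp W e f) g = pairing W g (rowOp W e f) :=
    tsum_congr fun m => by ring
  rw [hsymm, pairing_rowOp hW hf, pairing_rowOp hW hg]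
  have h1 : ∑' m, f m * (g (m + 1) / 2) = ∑' m, g m * (f (m - 1) / 2) := by
    rw [← (Equiv.addRight (1 : ℤ)).tsum_eq (fun m => g m * (f (m - 1) / 2))]
    refine tsum_congr fun m => ?_
    simp only [Equiv.coe_addRight, add_sub_cancel_right]; ring
  have h2 : ∑' m, f m * (g (m - 1) / 2) = ∑' m, g m * (f (m + 1) / 2) := by
    rw [← (Equiv.addRight (1 : ℤ)).tsum_eq (fun m => f m * (g (m - 1) / 2))]
    refine tsum_congr fun m => ?_
    simp only [Equiv.coe_addRight, add_sub_cancel_right]; ring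
  have h3 : ∑' m, f m * ((2 * W m - 2 - e m) / 2 * g m)
      = ∑' m, g m * ((2 * W m - 2 - e m) / 2 * f m) := tsum_congr fun m => by ring
  rw [h1, h2, h3]; ring

theorem pairing_self_nonneg (hW : ∀ m, 0 < W m) (f : ℤ → ℝ) : 0 ≤ pairing W f f :=
  tsum_nonneg fun m => by
    have := (hW m).le
    rw [mul_assoc]
    exact mul_nonneg this (mul_self_nonneg _)

/-- The diagonal of the form is at least ∑ f(m)², so the form is at least ½ ∑ (f(m) + f(m+1))². -/
theorem pairing_rowOp_self_nonneg {f : ℤ → ℝ} (hW : ∀ m, 0 < W m)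
    (he : ∀ m, e m + 4 ≤ 2 * W m) (hf : f.support.Finite) :
    0 ≤ pairing W f (rowOp W e f) := by
  rw [pairing_rowOp hW hf]
  have h2 : ∑' m, f m * (f (m - 1) / 2) = ∑' m, f m * (f (m + 1) / 2) := by
    rw [← (Equiv.addRight (1 : ℤ)).tsum_eq (fun m => f m * (f (m - 1) / 2))]
    refine tsum_congr fun m => ?_
    simp only [Equiv.coe_addRight, add_sub_cancel_right]; ring
  have h1 : ∑' m, f m * f m = ∑' m, f (m + 1) * f (m + 1) :=
    ((Equiv.addRight (1 : ℤ)).tsum_eq (fun m => f m * f m)).symm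
  have hs1 := summable_mul_of_support_finite hf f
  have hs2 : Summable fun m => f (m + 1) * f (m + 1) :=
    (Equiv.addRight (1 : ℤ)).summable_iff.mpr hs1
  have h3 : ∑' m, f m * f m ≤ ∑' m, f m * ((2 * W m - 2 - e m) / 2 * f m) :=
    hs1.tsum_le_tsum (fun m => by nlinarith [he m, mul_self_nonneg (f m)])
      (summable_mul_of_support_finite hf _)
  have h4 : 0 ≤ (∑' m, f m * f m) / 2 + (∑' m, f (m + 1) * f (m + 1)) / 2
      + 2 * ∑' m, f m * (f (m + 1) / 2) := by
    rw [← tsum_div_const, ← tsum_div_const, ← tsum_mul_left,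
      ← (hs1.div_const 2).tsum_add (hs2.div_const 2),
      ← ((hs1.div_const 2).add (hs2.div_const 2)).tsum_add
        ((summable_mul_of_support_finite hf _).mul_left 2)]
    exact tsum_nonneg fun m => by nlinarith [sq_nonneg (f m + f (m + 1))]
  linarith

theorem pairing_iterate_comm {f g : ℤ → ℝ} (hW : ∀ m, 0 < W m) (hf : f.support.Finite)
    (hg : g.support.Finite) (t : ℕ) :
    pairing W f ((rowOp W e)^[t] g) = pairing W ((rowOp W e)^[t] f) g := by
  induction t generalizing g with
  | zero => rfl
  | succ t ih =>
    rw [Function.iterate_succ_apply, ih (rowOp_support_finite hg), Function.iterate_succ_apply',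
      pairing_rowOp_comm hW (iterate_rowOp_support_finite hf t) hg]

/-- Self-adjointness moves half of the powers to the left factor: an even power is a square norm, an
odd one is the form of the operator at an iterate of `f`. -/
theorem pairing_iterate_self_nonneg {f : ℤ → ℝ} (hW : ∀ m, 0 < W m)
    (he : ∀ m, e m + 4 ≤ 2 * W m) (hf : f.support.Finite) (t : ℕ) :
    0 ≤ pairing W f ((rowOp W e)^[t] f) := by
  obtain ⟨s, rfl | rfl⟩ := Nat.even_or_odd' t
  · rw [two_mul, Function.iterate_add_apply,
      pairing_iterate_comm hW hf (iterate_rowOp_support_finite hf s)]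
    exact pairing_self_nonneg hW _
  · rw [two_mul, add_assoc, Function.iterate_add_apply, Function.iterate_succ_apply',
      pairing_iterate_comm hW hf (rowOp_support_finite (iterate_rowOp_support_finite hf s))]
    exact pairing_rowOp_self_nonneg hW he (iterate_rowOp_support_finite hf s)

theorem pairing_single (a : ℤ) (g : ℤ → ℝ) : pairing W (Pi.single a 1) g = W a * g a := by
  rw [pairing, tsum_eq_single a]
  · simp
  · intro b hb; simp [hb]

theorem single_support_finite (a : ℤ) : (Pi.single a 1 : ℤ → ℝ).support.Finite :=
  (Set.finite_singleton a).subset Pi.support_single_subset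

theorem rowKernel_reversible (hW : ∀ m, 0 < W m) (t : ℕ) (m n : ℤ) :
    W m * rowKernel W e t m n = W n * rowKernel W e t n m := by
  have h := pairing_iterate_comm (W := W) (e := e) hW (single_support_finite m)
    (single_support_finite n) t
  rw [pairing_single] at h
  rw [rowKernel, h, rowKernel, ← pairing_single (W := W) n]
  exact tsum_congr fun m => by ring

/-- The form `⟨g, T^t g⟩` for the dipole `g = δ_m / W m - δ_m' / W m'`. -/
noncomputable def dipoleForm (W e : ℤ → ℝ) (t : ℕ) (m m' : ℤ) : ℝ :=
  rowKernel W e t m m / W m + rowKernel W e t m' m' / W m'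
    - rowKernel W e t m m' / W m' - rowKernel W e t m' m / W m

theorem pairing_add_left {f g h : ℤ → ℝ} (hf : f.support.Finite) (hg : g.support.Finite) :
    pairing W (f + g) h = pairing W f h + pairing W g h := by
  have h1 := summable_mul_of_support_finite hf (fun m => W m * h m)
  have h2 := summable_mul_of_support_finite hg (fun m => W m * h m)
  have e1 : pairing W f h = ∑' m, f m * (W m * h m) := tsum_congr fun m => by ring
  have e2 : pairing W g h = ∑' m, g m * (W m * h m) := tsum_congr fun m => by ring
  rw [e1, e2, ← h1.tsum_add h2]
  exact tsum_congr fun m => by simp only [Pi.add_apply]; ring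

theorem pairing_smul_left (a : ℝ) (f h : ℤ → ℝ) :
    pairing W (a • f) h = a * pairing W f h := by
  rw [pairing, pairing, ← tsum_mul_left]
  exact tsum_congr fun m => by simp only [Pi.smul_apply, smul_eq_mul]; ring

theorem smul_support_finite {f : ℤ → ℝ} (a : ℝ) (hf : f.support.Finite) :
    (a • f).support.Finite :=
  hf.subset (Function.support_const_smul_subset a f)

theorem add_support_finite {f g : ℤ → ℝ} (hf : f.support.Finite) (hg : g.support.Finite) :
    (f + g).support.Finite :=
  (hf.union hg).subset (Function.support_add f g)

/-- Cauchy-Schwarz for the gradient of the kernel, in additive form. -/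
theorem abs_rowKernel_sub_le (hW : ∀ m, 0 < W m) (he : ∀ m, e m + 4 ≤ 2 * W m) (t : ℕ)
    (m m' n : ℤ) {ε : ℝ} (hε : 0 < ε) :
    |rowKernel W e t m n - rowKernel W e t m' n|
      ≤ (ε * (W n * rowKernel W e t n n) + ε⁻¹ * dipoleForm W e t m m') / 2 := by
  -- The positive form at ε δ_n + b (δ_m / W m - δ_m' / W m'). Taking b = 1 and b = -1 gives the two
  -- one-sided bounds.
  have key : ∀ b : ℝ, 0 ≤ ε * ε * (W n * rowKernel W e t n n)
      + 2 * ε * b * (rowKernel W e t m n - rowKernel W e t m' n)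
      + b * b * dipoleForm W e t m m' := by
    intro b
    have hs := single_support_finite
    have h1 := smul_support_finite ε (hs n)
    have h2 := smul_support_finite (b / W m) (hs m)
    have h3 := smul_support_finite (-b / W m') (hs m')
    have h := pairing_iterate_self_nonneg (e := e) hW he
      (add_support_finite (add_support_finite h1 h2) h3) t
    rw [pairing_add_left (add_support_finite h1 h2) h3, pairing_add_left h1 h2,
      pairing_smul_left, pairing_smul_left, pairing_smul_left, pairing_single, pairing_single,
      pairing_single] at h
    simp only [iterate_rowOp_add, iterate_rowOp_smul, Pi.add_apply, Pi.smul_apply,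
      smul_eq_mul] at h
    change 0 ≤ ε * (W n * (ε * rowKernel W e t n n + b / W m * rowKernel W e t n m
        + -b / W m' * rowKernel W e t n m'))
      + b / W m * (W m * (ε * rowKernel W e t m n + b / W m * rowKernel W e t m m
        + -b / W m' * rowKernel W e t m m'))
      + -b / W m' * (W m' * (ε * rowKernel W e t m' n + b / W m * rowKernel W e t m' m
        + -b / W m' * rowKernel W e t m' m')) at h
    have r1 := rowKernel_reversible (e := e) hW t n m
    have r2 := rowKernel_reversible (e := e) hW t n m'
    have hm := (hW m).ne'
    have hm' := (hW m').ne'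
    refine h.trans (le_of_eq ?_)
    rw [dipoleForm]
    have r1' : rowKernel W e t m n = W n * rowKernel W e t n m / W m := by
      rw [r1]; field_simp
    have r2' : rowKernel W e t m' n = W n * rowKernel W e t n m' / W m' := by
      rw [r2]; field_simp
    rw [r1', r2']
    field_simp
    ring
  have hε' : ε * ε⁻¹ = 1 := mul_inv_cancel₀ hε.ne'
  have hi : 0 < ε⁻¹ := inv_pos.mpr hε
  rw [abs_le]
  constructor
  · have h := mul_nonneg hi.le (key 1)
    have e1 : ε⁻¹ * (ε * ε * (W n * rowKernel W e t n n)
      + 2 * ε * 1 * (rowKernel W e t m n - rowKernel W e t m' n)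
      + 1 * 1 * dipoleForm W e t m m') = ε * (W n * rowKernel W e t n n)
      + 2 * (rowKernel W e t m n - rowKernel W e t m' n) + ε⁻¹ * dipoleForm W e t m m' := by
      field_simp
    linarith
  · have h := mul_nonneg hi.le (key (-1))
    have e1 : ε⁻¹ * (ε * ε * (W n * rowKernel W e t n n)
      + 2 * ε * (-1) * (rowKernel W e t m n - rowKernel W e t m' n)
      + (-1) * (-1) * dipoleForm W e t m m') = ε * (W n * rowKernel W e t n n)
      - 2 * (rowKernel W e t m n - rowKernel W e t m' n) + ε⁻¹ * dipoleForm W e t m m' := by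
      field_simp
      ring
    linarith

end kernel

/-! ### Cosine coefficients on `(0, π)` -/

theorem integrableOn_Ioo_of_continuous {f : ℝ → ℝ} (hf : Continuous f) :
    IntegrableOn f (Set.Ioo 0 Real.pi) :=
  (hf.integrableOn_Icc (a := 0) (b := Real.pi)).mono_set Set.Ioo_subset_Icc_self

theorem integrableOn_Ioo_of_bounded {f : ℝ → ℝ} (hf : Measurable f) {C : ℝ}
    (hC : ∀ θ ∈ Set.Ioo 0 Real.pi, |f θ| ≤ C) : IntegrableOn f (Set.Ioo 0 Real.pi) :=
  Measure.integrableOn_of_bounded (M := C) (by simp) hf.aestronglyMeasurable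
    ((ae_restrict_iff' measurableSet_Ioo).mpr (ae_of_all _ hC))

/-- Exchange of a series and an integral over `(0, π)` under an explicit summable majorant. -/
theorem hasSum_integral_Ioo {ι : Type*} [Countable ι] {F : ι → ℝ → ℝ} {f : ℝ → ℝ}
    (bound : ι → ℝ → ℝ) {total : ℝ → ℝ} (hF : ∀ i, Measurable (F i))
    (hb : ∀ i, ∀ θ ∈ Set.Ioo 0 Real.pi, |F i θ| ≤ bound i θ)
    (hs : ∀ θ ∈ Set.Ioo 0 Real.pi, HasSum (fun i => bound i θ) (total θ))
    (hi : IntegrableOn total (Set.Ioo 0 Real.pi))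
    (hl : ∀ θ ∈ Set.Ioo 0 Real.pi, HasSum (fun i => F i θ) (f θ)) :
    HasSum (fun i => ∫ θ in Set.Ioo 0 Real.pi, F i θ) (∫ θ in Set.Ioo 0 Real.pi, f θ) := by
  have mem := ae_restrict_mem (μ := (volume : Measure ℝ)) (measurableSet_Ioo (a := 0) (b := Real.pi))
  refine hasSum_integral_of_dominated_convergence bound (fun i => (hF i).aestronglyMeasurable)
    (fun i => mem.mono fun θ h => hb i θ h) (mem.mono fun θ h => (hs θ h).summable) ?_
    (mem.mono fun θ h => hl θ h)
  refine Integrable.congr hi (mem.mono fun θ h => ?_)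
  exact (hs θ h).tsum_eq.symm

/-- The cosine coefficient `(1/π) ∫_0^π cos (a θ) f θ dθ`. -/
noncomputable def cosCoeff (f : ℝ → ℝ) (a : ℤ) : ℝ :=
  1 / Real.pi * ∫ θ in Set.Ioo 0 Real.pi, Real.cos (a * θ) * f θ

theorem integrableOn_cos_mul {f : ℝ → ℝ} (hf : Continuous f) (a : ℤ) :
    IntegrableOn (fun θ => Real.cos (a * θ) * f θ) (Set.Ioo 0 Real.pi) :=
  integrableOn_Ioo_of_continuous (by fun_prop)

theorem cosCoeff_one (a : ℤ) : cosCoeff (fun _ => 1) a = if a = 0 then 1 else 0 := by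
  have hpi := Real.pi_pos
  rw [cosCoeff, ← integral_Ioc_eq_integral_Ioo, ← intervalIntegral.integral_of_le hpi.le]
  split_ifs with h
  · subst h; simp [hpi.ne']
  · have ha : (a : ℝ) ≠ 0 := by exact_mod_cast h
    simp [intervalIntegral.integral_comp_mul_left (fun x => Real.cos x) ha]

theorem cosCoeff_add {f g : ℝ → ℝ} (hf : Continuous f) (hg : Continuous g) (a : ℤ) :
    cosCoeff (fun θ => f θ + g θ) a = cosCoeff f a + cosCoeff g a := by
  simp only [cosCoeff, mul_add]
  rw [integral_add (integrableOn_cos_mul hf a) (integrableOn_cos_mul hg a)]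
  ring

theorem cosCoeff_const_mul (f : ℝ → ℝ) (c : ℝ) (a : ℤ) :
    cosCoeff (fun θ => c * f θ) a = c * cosCoeff f a := by
  simp only [cosCoeff]
  rw [show (fun θ => Real.cos (a * θ) * (c * f θ)) = fun θ => c * (Real.cos (a * θ) * f θ) by
    ext θ; ring, integral_const_mul]
  ring

/-- A symmetric pair of jumps by ±b acts on the frequency side as multiplication by 2 cos (bθ). -/
theorem cosCoeff_shift {f : ℝ → ℝ} (hf : Continuous f) (a b : ℤ) :
    cosCoeff f (a - b) + cosCoeff f (a + b)
      = cosCoeff (fun θ => 2 * Real.cos (b * θ) * f θ) a := by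
  simp only [cosCoeff]
  rw [← mul_add, ← integral_add (integrableOn_cos_mul hf _) (integrableOn_cos_mul hf _)]
  congr 2
  ext θ
  push_cast
  rw [sub_mul, add_mul, Real.cos_sub, Real.cos_add]
  ring

theorem cosCoeff_cos (a j : ℤ) :
    cosCoeff (fun θ => Real.cos (j * θ)) a
      = ((if a - j = 0 then 1 else 0) + if a + j = 0 then 1 else 0) / 2 := by
  have h := cosCoeff_const_mul (fun θ => Real.cos (j * θ)) 2 a
  rw [← cosCoeff_one, ← cosCoeff_one, cosCoeff_shift continuous_const]
  simp only [mul_one]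
  linarith

/-! ### The Poisson kernel -/

/-- Two geometric series in ρ e^{±iθ} add up to a real number; multiplying by e^{ib} and taking real
parts then brings in the phase b. -/
theorem hasSum_pow_natAbs_mul_cos {ρ : ℝ} (hρ : |ρ| < 1) (b θ : ℝ) :
    HasSum (fun k : ℤ => ρ ^ k.natAbs * Real.cos (b + k * θ))
      ((1 - ρ ^ 2) / (1 - 2 * ρ * Real.cos θ + ρ ^ 2) * Real.cos b) := by
  have hdpos : 0 < 1 - 2 * ρ * Real.cos θ + ρ ^ 2 := by
    have h1 := abs_lt.mp hρ
    have h2 := Real.sin_sq_add_cos_sq θ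
    by_contra hc
    have h3 : (1 - ρ * Real.cos θ) = 0 ∨ 0 < (ρ * Real.sin θ) ^ 2 + (1 - ρ * Real.cos θ) ^ 2 := by
      by_cases h : 1 - ρ * Real.cos θ = 0
      · exact Or.inl h
      · exact Or.inr (by positivity)
    rcases h3 with h3 | h3
    · nlinarith [Real.neg_one_le_cos θ, Real.cos_le_one θ, abs_le.mp (Real.abs_cos_le_one θ),
        abs_mul ρ (Real.cos θ), le_abs_self (ρ * Real.cos θ),
        mul_le_mul_of_nonneg_left (Real.abs_cos_le_one θ) (abs_nonneg ρ)]
    · nlinarith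
  set ξ : ℂ := Complex.exp (θ * Complex.I) with hξ
  have hξ0 : ξ ≠ 0 := Complex.exp_ne_zero _
  have hξn : ‖ξ‖ = 1 := Complex.norm_exp_ofReal_mul_I θ
  have hn1 : ‖(ρ : ℂ) * ξ‖ < 1 := by simpa [hξn] using hρ
  have hn2 : ‖(ρ : ℂ) * ξ⁻¹‖ < 1 := by simpa [hξn] using hρ
  have h1 := hasSum_geometric_of_norm_lt_one hn1
  have h2 := (hasSum_geometric_of_norm_lt_one hn2).mul_left ((ρ : ℂ) * ξ⁻¹)
  have h3 : HasSum (fun k : ℤ => (ρ : ℂ) ^ k.natAbs * ξ ^ k)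
      ((1 - (ρ : ℂ) * ξ)⁻¹ + (ρ : ℂ) * ξ⁻¹ * (1 - (ρ : ℂ) * ξ⁻¹)⁻¹) := by
    refine HasSum.of_nat_of_neg_add_one ?_ ?_
    · simpa [mul_pow] using h1
    · refine h2.congr_fun fun n => ?_
      have : (-((n : ℤ) + 1)).natAbs = n + 1 := by omega
      rw [this, ← pow_succ', mul_pow, zpow_neg, inv_pow]
      norm_cast
  have h4 := Complex.hasSum_re (h3.mul_left (Complex.exp (b * Complex.I)))
  have hval : (1 - (ρ : ℂ) * ξ)⁻¹ + (ρ : ℂ) * ξ⁻¹ * (1 - (ρ : ℂ) * ξ⁻¹)⁻¹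
      = (((1 - ρ ^ 2) / (1 - 2 * ρ * Real.cos θ + ρ ^ 2) : ℝ) : ℂ) := by
    have d1 : 1 - (ρ : ℂ) * ξ ≠ 0 := fun h => by
      rw [← sub_eq_zero.mp h] at hn1; simp at hn1
    have d2 : 1 - (ρ : ℂ) * ξ⁻¹ ≠ 0 := fun h => by
      rw [← sub_eq_zero.mp h] at hn2; simp at hn2
    have hcos : 2 * (Real.cos θ : ℂ) = ξ + ξ⁻¹ := by
      rw [hξ, ← Complex.exp_neg, Complex.ofReal_cos, Complex.cos]
      ring_nf
    have hden : ((1 - 2 * ρ * Real.cos θ + ρ ^ 2 : ℝ) : ℂ) = (1 - ρ * ξ) * (1 - ρ * ξ⁻¹) := by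
      push_cast at hcos ⊢
      linear_combination (-(ρ : ℂ)) * hcos - (ρ : ℂ) ^ 2 * mul_inv_cancel₀ hξ0
    rw [Complex.ofReal_div, hden]
    push_cast
    have d3 : ξ - ρ ≠ 0 := by
      intro h; apply d2; rw [← sub_eq_zero.mp h, mul_inv_cancel₀ hξ0, sub_self]
    rw [eq_div_iff (mul_ne_zero d1 d2), add_mul]
    rw [← mul_assoc, inv_mul_cancel₀ d1, mul_comm (1 - (ρ : ℂ) * ξ), mul_assoc, ← mul_assoc _ _ (1 - (ρ : ℂ) * ξ),
      inv_mul_cancel₀ d2]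
    field_simp
    ring
  rw [hval] at h4
  convert h4 using 1
  · ext k
    rw [hξ, ← Complex.exp_int_mul, mul_left_comm, ← Complex.exp_add, ← Complex.ofReal_pow,
      Complex.re_ofReal_mul]
    congr 1
    rw [show (b : ℂ) * Complex.I + k * (θ * Complex.I) = ((b + k * θ : ℝ) : ℂ) * Complex.I by
      push_cast; ring, Complex.exp_ofReal_mul_I_re]
  · rw [mul_comm (Complex.exp _), Complex.re_ofReal_mul, Complex.exp_ofReal_mul_I_re]

/-! ### The effective weights form a symmetric geometric distribution -/

/-- The characteristic function of a step of the auxiliary walk. -/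
noncomputable def auxChar (z θ : ℝ) : ℝ := (z ^ 2 * Real.cos θ + Real.cos (2 * θ)) / (1 + z ^ 2)

theorem continuous_auxChar (z : ℝ) : Continuous (auxChar z) := by
  unfold auxChar
  fun_prop

theorem auxProb_eq (z : ℝ) (n : ℕ) (k : ℤ) :
    auxProb z n k = cosCoeff (fun θ => auxChar z θ ^ n) k := by
  induction n generalizing k with
  | zero => simp [auxProb, cosCoeff_one]
  | succ n ih =>
    have hc : Continuous fun θ => auxChar z θ ^ n := (continuous_auxChar z).pow n
    rw [auxProb, ih, ih, ih, ih, cosCoeff_shift hc, cosCoeff_shift hc,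
      ← cosCoeff_const_mul, ← cosCoeff_const_mul, ← cosCoeff_add (by fun_prop) (by fun_prop)]
    congr 1
    ext θ
    rw [pow_succ' (auxChar z θ) n]
    generalize auxChar z θ ^ n = Q
    rw [auxChar]
    push_cast
    rw [one_mul]
    have : 1 + z ^ 2 ≠ 0 := by positivity
    have h2 : 2 + 2 * z ^ 2 ≠ 0 := by positivity
    field_simp

/-- The zero at θ = 0 is isolated in the factor 1 - cos θ, which the second difference of the
potential will cancel. -/
theorem one_sub_auxChar (z θ : ℝ) :
    1 - auxChar z θ = (1 - Real.cos θ) * ((z ^ 2 + 2 + 2 * Real.cos θ) / (1 + z ^ 2)) := by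
  have : 1 + z ^ 2 ≠ 0 := by positivity
  rw [auxChar, Real.cos_two_mul]
  field_simp
  ring

theorem cos_lt_one_of_mem {θ : ℝ} (hθ : θ ∈ Set.Ioo 0 Real.pi) : Real.cos θ < 1 := by
  rw [← Real.cos_zero]
  exact Real.cos_lt_cos_of_nonneg_of_le_pi le_rfl hθ.2.le hθ.1

/-- The value 1 is approached only at θ = 0, quadratically. The value -1 is never attained: with x =
cos θ this would force z² (1 + x) + 2 x² = 0. The absolute value is needed for dominated convergence
of the series in n. -/
theorem exists_one_sub_abs_auxChar_ge {z : ℝ} (hz : 0 < z) :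
    ∃ c : ℝ, 0 < c ∧ ∀ θ, c * (1 - Real.cos θ) ≤ 1 - |auxChar z θ| := by
  refine ⟨min (z ^ 2 / 4) (1 / 4) / (1 + z ^ 2), by positivity, fun θ => ?_⟩
  have h1 := Real.cos_le_one θ
  have h2 := Real.neg_one_le_cos θ
  have hz2 : 0 < z ^ 2 := by positivity
  have m1 := min_le_left (z ^ 2 / 4) (1 / 4)
  have m2 := min_le_right (z ^ 2 / 4) (1 / 4)
  have key : min (z ^ 2 / 4) (1 / 4) * (1 - Real.cos θ)
      ≤ (1 + z ^ 2) - |z ^ 2 * Real.cos θ + Real.cos (2 * θ)| := by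
    rw [Real.cos_two_mul]
    set x := Real.cos θ
    rcases abs_cases (z ^ 2 * x + (2 * x ^ 2 - 1)) with ⟨h, -⟩ | ⟨h, -⟩
    · rw [h]
      have : min (z ^ 2 / 4) (1 / 4) * (1 - x) ≤ z ^ 2 / 4 * (1 - x) :=
        mul_le_mul_of_nonneg_right m1 (by linarith)
      nlinarith [mul_nonneg (sub_nonneg.mpr h1) (by linarith : (0 : ℝ) ≤ 1 + x)]
    · rw [h]
      -- For x ≤ -1/2 the term 2 x² gives the bound, otherwise z² (1 + x) does.
      rcases le_or_gt x (-1 / 2) with hx | hx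
      · have : min (z ^ 2 / 4) (1 / 4) * (1 - x) ≤ 1 / 4 * (1 - x) :=
          mul_le_mul_of_nonneg_right m2 (by linarith)
        nlinarith
      · have : min (z ^ 2 / 4) (1 / 4) * (1 - x) ≤ z ^ 2 / 4 * (1 - x) :=
          mul_le_mul_of_nonneg_right m1 (by linarith)
        nlinarith
  have hp : 0 < 1 + z ^ 2 := by positivity
  rw [auxChar, abs_div, abs_of_pos hp, div_mul_eq_mul_div, div_le_iff₀ hp, sub_mul,
    div_mul_cancel₀ _ hp.ne', one_mul]
  exact key

theorem one_sub_cos_int_mul_le (k : ℤ) {θ : ℝ} (hθ : θ ∈ Set.Ioo 0 Real.pi) :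
    1 - Real.cos (k * θ) ≤ (k ^ 2 * Real.pi ^ 2 / 4) * (1 - Real.cos θ) := by
  have h1 := Real.one_sub_sq_div_two_le_cos (x := k * θ)
  have h2 := Real.cos_le_one_sub_mul_cos_sq (x := θ) (by rw [abs_of_pos hθ.1]; exact hθ.2.le)
  have hp := Real.pi_pos
  have h3 : 2 / Real.pi ^ 2 * θ ^ 2 ≤ 1 - Real.cos θ := by linarith
  calc 1 - Real.cos (k * θ) ≤ k ^ 2 * Real.pi ^ 2 / 4 * (2 / Real.pi ^ 2 * θ ^ 2) := by
        field_simp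
        nlinarith
    _ ≤ _ := mul_le_mul_of_nonneg_left h3 (by positivity)

/-- The function `h` is either the characteristic function (for the integrand) or its absolute value
(for the majorant). Numerator and denominator both vanish quadratically at 0, so the quotient is
bounded. -/
theorem integrableOn_div_one_sub_auxChar {z : ℝ} (hz : 0 < z) (k : ℤ) (h : ℝ → ℝ)
    (hm : Measurable h) (hle : ∀ θ, |auxChar z θ| ≤ 1 → h θ ≤ |auxChar z θ|) :
    IntegrableOn (fun θ => (1 - Real.cos (k * θ)) / (1 - h θ)) (Set.Ioo 0 Real.pi) := by
  obtain ⟨c, hc, hb⟩ := exists_one_sub_abs_auxChar_ge hz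
  refine integrableOn_Ioo_of_bounded (C := k ^ 2 * Real.pi ^ 2 / 4 / c)
    ((by fun_prop : Measurable fun θ : ℝ => 1 - Real.cos (k * θ)).div (measurable_const.sub hm))
    fun θ hθ => ?_
  have h1 := cos_lt_one_of_mem hθ
  have h2 : 0 < c * (1 - Real.cos θ) := mul_pos hc (by linarith)
  have h3 := hb θ
  have h4 := hle θ (by linarith)
  have h5 := one_sub_cos_int_mul_le k hθ
  rw [abs_of_nonneg (div_nonneg (by linarith [Real.cos_le_one (k * θ)]) (by linarith)),
    div_le_iff₀ (by linarith)]
  calc 1 - Real.cos (k * θ) ≤ _ := h5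
    _ = k ^ 2 * Real.pi ^ 2 / 4 / c * (c * (1 - Real.cos θ)) := by field_simp
    _ ≤ _ := mul_le_mul_of_nonneg_left (by linarith) (by positivity)

theorem auxPotential_eq {z : ℝ} (hz : 0 < z) (k : ℤ) :
    auxPotential z k = 1 / Real.pi *
      ∫ θ in Set.Ioo 0 Real.pi, (1 - Real.cos (k * θ)) / (1 - auxChar z θ) := by
  obtain ⟨c, hc, hb⟩ := exists_one_sub_abs_auxChar_ge hz
  have hlt : ∀ θ ∈ Set.Ioo 0 Real.pi, |auxChar z θ| < 1 := fun θ hθ => by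
    have := hb θ
    have h2 : 0 < c * (1 - Real.cos θ) := mul_pos hc (by linarith [cos_lt_one_of_mem hθ])
    linarith
  have hcont := continuous_auxChar z
  have main := hasSum_integral_Ioo (ι := ℕ)
    (F := fun n θ => (1 - Real.cos (k * θ)) * auxChar z θ ^ n)
    (f := fun θ => (1 - Real.cos (k * θ)) / (1 - auxChar z θ))
    (fun n θ => (1 - Real.cos (k * θ)) * |auxChar z θ| ^ n)
    (total := fun θ => (1 - Real.cos (k * θ)) / (1 - |auxChar z θ|))
    (fun n => (by fun_prop : Continuous _).measurable)
    (fun n θ _ => by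
      rw [abs_mul, abs_pow, abs_of_nonneg (by linarith [Real.cos_le_one (k * θ)])])
    (fun θ hθ => (hasSum_geometric_of_lt_one (abs_nonneg _) (hlt θ hθ)).mul_left _)
    (integrableOn_div_one_sub_auxChar hz k (fun θ => |auxChar z θ|)
      (by fun_prop) fun θ _ => le_rfl)
    (fun θ hθ => (hasSum_geometric_of_abs_lt_one (hlt θ hθ)).mul_left _)
  rw [auxPotential, ← (main.mul_left (1 / Real.pi)).tsum_eq]
  refine tsum_congr fun n => ?_
  have hp : Continuous fun θ => auxChar z θ ^ n := hcont.pow n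
  rw [auxProb_eq, auxProb_eq, cosCoeff, cosCoeff, ← mul_sub,
    ← integral_sub (integrableOn_cos_mul hp 0) (integrableOn_cos_mul hp k)]
  congr 2
  ext θ
  simp
  ring

/-- The ratio of the geometric distribution `q`. -/
noncomputable def effRatio (z : ℝ) : ℝ := Real.exp (-(2 * Real.arsinh (z / 2)))

theorem effRatio_pos (z : ℝ) : 0 < effRatio z := Real.exp_pos _

theorem effRatio_lt_one {z : ℝ} (hz : 0 < z) : effRatio z < 1 := by
  rw [effRatio, Real.exp_lt_one_iff]
  have := Real.arsinh_pos_iff.mpr (half_pos hz)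
  linarith

/-- With u = arsinh x, this is (1 - e^{-2u})² = 4 sinh² u · e^{-2u}. It governs both `effRatio` and
`decay`. -/
theorem exp_two_arsinh_quadratic (x : ℝ) :
    (1 - Real.exp (-(2 * Real.arsinh x))) ^ 2
      = 4 * x ^ 2 * Real.exp (-(2 * Real.arsinh x)) := by
  have h := Real.sinh_arsinh x
  rw [Real.sinh_eq] at h
  have h2 : Real.exp (-(2 * Real.arsinh x)) = Real.exp (-Real.arsinh x) ^ 2 := by
    rw [← Real.exp_nat_mul]; congr 1; push_cast; ring
  have h3 : Real.exp (Real.arsinh x) * Real.exp (-Real.arsinh x) = 1 := by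
    rw [← Real.exp_add]; simp
  rw [h2]
  set a := Real.exp (Real.arsinh x)
  set b := Real.exp (-Real.arsinh x)
  have hx : 4 * x ^ 2 = (a - b) ^ 2 := by rw [← h]; ring
  linear_combination (-(1 + a * b - 2 * b ^ 2)) * h3 - b ^ 2 * hx

theorem effRatio_quadratic (z : ℝ) : (1 - effRatio z) ^ 2 = z ^ 2 * effRatio z := by
  have := exp_two_arsinh_quadratic (z / 2)
  rw [effRatio, this]
  ring

/-- For the ratio r = `effRatio z`, the left side is (1 - r)² / ((1 - r)² + 2r (1 - x)), and (1 -
r)² = z² r removes r. -/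
theorem poisson_effRatio (z x : ℝ) (hz : 0 < z) (hx : x ≤ 1) :
    (1 - effRatio z) / (1 + effRatio z) *
        ((1 - effRatio z ^ 2) / (1 - 2 * effRatio z * x + effRatio z ^ 2))
      = z ^ 2 / (z ^ 2 + 2 - 2 * x) := by
  have h1 := effRatio_pos z
  have h2 := effRatio_lt_one hz
  have h3 := effRatio_quadratic z
  have d1 : 0 < 1 - 2 * effRatio z * x + effRatio z ^ 2 := by nlinarith
  have d2 : 0 < z ^ 2 + 2 - 2 * x := by nlinarith
  rw [div_mul_div_comm, div_eq_div_iff (by positivity) d2.ne']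
  linear_combination (2 - 2 * x) * (1 + effRatio z) * h3

/-- The second difference has numerator -2 cos (kθ) (1 - cos θ), whose last factor cancels the zero
of 1 - `auxChar z θ`. -/
theorem effWeight_eq_cosCoeff {z : ℝ} (hz : 0 < z) (k : ℤ) :
    effWeight z k
      = (-1) ^ k * cosCoeff (fun θ => z ^ 2 / (z ^ 2 + 2 - 2 * (-Real.cos θ))) k := by
  have hi := fun k => integrableOn_div_one_sub_auxChar hz k (auxChar z)
    (continuous_auxChar z).measurable fun θ _ => le_abs_self _
  have hcomb : 2 * auxPotential z k - auxPotential z (k + 1) - auxPotential z (k - 1)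
      = 1 / Real.pi * ∫ θ in Set.Ioo 0 Real.pi, (-(2 * (1 + z ^ 2) / z ^ 2)) *
        (Real.cos (k * θ) * (z ^ 2 / (z ^ 2 + 2 - 2 * (-Real.cos θ)))) := by
    rw [auxPotential_eq hz, auxPotential_eq hz, auxPotential_eq hz]
    rw [show ∀ a b c d : ℝ, 2 * (d * a) - d * b - d * c = d * (2 * a - b - c) by intros; ring]
    congr 1
    have hi2 : IntegrableOn (fun θ => 2 * ((1 - Real.cos (k * θ)) / (1 - auxChar z θ))
        - (1 - Real.cos ((k + 1 : ℤ) * θ)) / (1 - auxChar z θ)) (Set.Ioo 0 Real.pi) :=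
      ((hi k).const_mul 2).sub (hi (k + 1))
    rw [← integral_const_mul, ← integral_sub ((hi k).const_mul 2) (hi (k + 1)),
      ← integral_sub hi2 (hi (k - 1))]
    refine setIntegral_congr_fun measurableSet_Ioo fun θ hθ => ?_
    have h1 : 1 - Real.cos θ ≠ 0 := by linarith [cos_lt_one_of_mem hθ]
    have h2 : z ^ 2 + 2 + 2 * Real.cos θ ≠ 0 := by
      have := Real.neg_one_le_cos θ
      nlinarith [hz]
    have h3 : 1 + z ^ 2 ≠ 0 := by positivity
    simp only [one_sub_auxChar]
    push_cast
    rw [add_mul (k : ℝ) 1 θ, sub_mul (k : ℝ) 1 θ, one_mul, Real.cos_add, Real.cos_sub,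
      show z ^ 2 + 2 - 2 * (-Real.cos θ) = z ^ 2 + 2 + 2 * Real.cos θ by ring]
    field_simp
    ring
  rw [effWeight, hcomb, integral_const_mul, cosCoeff, zpow_add₀ (by norm_num)]
  have h3 : 1 + z ^ 2 ≠ 0 := by positivity
  rw [show 2 + 2 * z ^ 2 = 2 * (1 + z ^ 2) by ring]
  field_simp

theorem neg_one_zpow_eq_pow_natAbs (k : ℤ) : (-1 : ℝ) ^ k = (-1) ^ k.natAbs := by
  obtain ⟨n, rfl | rfl⟩ := k.eq_nat_or_neg
  · simp
  · simp [← inv_pow, inv_neg]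

/-- The integrand is expanded as a Poisson kernel of ratio -r, because cos θ enters with the
opposite sign; the factor (-1)^k in the weight turns -r into r. -/
theorem effWeight_eq {z : ℝ} (hz : 0 < z) (k : ℤ) :
    effWeight z k = (1 - effRatio z) / (1 + effRatio z) * effRatio z ^ k.natAbs := by
  have h1 := effRatio_pos z
  have h2 := effRatio_lt_one hz
  set r := effRatio z with hr
  set A := (1 - r) / (1 + r)
  have hA : 0 < A := div_pos (by linarith) (by linarith)
  have habs : |-r| < 1 := by rw [abs_neg, abs_of_pos h1]; exact h2
  have hr' : |r| < 1 := by rwa [abs_of_pos h1]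
  have hgeo : HasSum (fun j : ℤ => r ^ j.natAbs) ((1 - r ^ 2) / (1 - 2 * r + r ^ 2)) := by
    simpa using hasSum_pow_natAbs_mul_cos hr' 0 0
  have main := hasSum_integral_Ioo (ι := ℤ)
    (F := fun j θ => Real.cos (k * θ) * (A * ((-r) ^ j.natAbs * Real.cos (j * θ))))
    (f := fun θ => Real.cos (k * θ) * (z ^ 2 / (z ^ 2 + 2 - 2 * (-Real.cos θ))))
    (fun j _ => A * r ^ j.natAbs)
    (total := fun _ => A * ((1 - r ^ 2) / (1 - 2 * r + r ^ 2)))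
    (fun j => (by fun_prop : Continuous _).measurable)
    (fun j θ _ => by
      rw [abs_mul, abs_mul, abs_mul, abs_pow, abs_neg, abs_of_pos h1, abs_of_pos hA]
      have e1 := Real.abs_cos_le_one (k * θ)
      have e2 := Real.abs_cos_le_one (j * θ)
      calc _ ≤ 1 * (A * (r ^ j.natAbs * 1)) := by gcongr
        _ = _ := by ring)
    (fun θ _ => hgeo.mul_left A)
    (integrableOn_Ioo_of_continuous continuous_const)
    (fun θ _ => by
      have h := ((hasSum_pow_natAbs_mul_cos habs 0 θ).mul_left A).mul_left (Real.cos (k * θ))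
      simp only [zero_add, Real.cos_zero, mul_one] at h
      have e : z ^ 2 / (z ^ 2 + 2 - 2 * (-Real.cos θ))
          = A * ((1 - (-r) ^ 2) / (1 - 2 * (-r) * Real.cos θ + (-r) ^ 2)) := by
        rw [← poisson_effRatio z (-Real.cos θ) hz (by linarith [Real.neg_one_le_cos θ]), ← hr]
        ring
      rw [e]
      exact h)
  have hsum := main.mul_left (1 / Real.pi)
  -- By orthogonality only j = k and j = -k survive, with one half each; for k = 0 both halves fall
  -- on the same index.
  have hterm : ∀ j : ℤ, 1 / Real.pi * ∫ θ in Set.Ioo 0 Real.pi,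
      Real.cos (k * θ) * (A * ((-r) ^ j.natAbs * Real.cos (j * θ)))
      = (if j = k then A * (-r) ^ k.natAbs / 2 else 0)
        + if j = -k then A * (-r) ^ k.natAbs / 2 else 0 := by
    intro j
    have := cosCoeff_const_mul (fun θ => Real.cos (j * θ)) (A * (-r) ^ j.natAbs) k
    rw [cosCoeff_cos] at this
    simp only [cosCoeff, ← mul_assoc] at this ⊢
    simp only [mul_assoc] at this ⊢
    rw [this]
    have e1 : k - j = 0 ↔ j = k := by omega
    have e2 : k + j = 0 ↔ j = -k := by omega
    simp only [e1, e2]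
    split_ifs with c1 c2 c2
    · rw [c1]; ring
    · rw [c1]; ring
    · rw [c2, Int.natAbs_neg]; ring
    · ring
  simp only [hterm] at hsum
  have hval := hsum.unique ((hasSum_ite_eq k _).add (hasSum_ite_eq (-k) _))
  rw [effWeight_eq_cosCoeff hz, cosCoeff, hval, add_halves]
  have hsign : (-1 : ℝ) ^ k * (-r) ^ k.natAbs = r ^ k.natAbs := by
    rw [neg_one_zpow_eq_pow_natAbs, ← mul_pow]; simp
  rw [← hsign]; ring

theorem hasSum_effWeight_mul_cos {z : ℝ} (hz : 0 < z) (b θ : ℝ) :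
    HasSum (fun k : ℤ => effWeight z k * Real.cos (b + k * θ))
      (z ^ 2 / (z ^ 2 + 2 - 2 * Real.cos θ) * Real.cos b) := by
  have h1 := effRatio_pos z
  have h2 := effRatio_lt_one hz
  have h := (hasSum_pow_natAbs_mul_cos (ρ := effRatio z) (by rwa [abs_of_pos h1]) b θ).mul_left
    ((1 - effRatio z) / (1 + effRatio z))
  rw [← mul_assoc, poisson_effRatio z _ hz (Real.cos_le_one θ)] at h
  simpa only [effWeight_eq hz, mul_assoc] using h

theorem hasSum_effWeight {z : ℝ} (hz : 0 < z) : HasSum (effWeight z) 1 := by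
  have h := hasSum_effWeight_mul_cos hz 0 0
  simpa [hz.ne'] using h

theorem effWeight_nonneg {z : ℝ} (hz : 0 < z) (k : ℤ) : 0 ≤ effWeight z k := by
  have h1 := effRatio_pos z
  have h2 := effRatio_lt_one hz
  rw [effWeight_eq hz]
  exact mul_nonneg (div_nonneg (by linarith) (by linarith)) (by positivity)

/-! ### Horizontal Fourier representation of the lazy walk -/

/-- The characteristic function of the effective weights. -/
noncomputable def effChar (z θ : ℝ) : ℝ := z ^ 2 / (z ^ 2 + 2 - 2 * Real.cos θ)

/-- The total conductance at a vertex of row `m`. -/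
noncomputable def weight (lam : ℝ) (m : ℤ) : ℝ := if m = 0 then 2 + 3 * lam else 4

/-- The killing in row `m` at horizontal frequency `θ`. -/
noncomputable def mass (z lam θ : ℝ) (m : ℤ) : ℝ :=
  if m = 0 then lam * (4 * Real.sin θ ^ 2 + (1 - effChar z θ)) else 4 * Real.sin θ ^ 2

/-- The conductance of the horizontal edges of displacement `k` in row `m`. -/
noncomputable def rowConductance (z lam : ℝ) (m k : ℤ) : ℝ :=
  (if m = 0 then lam else 1) * (if k.natAbs = 2 then 1 else 0)
    + if m = 0 then lam * effWeight z k else 0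

theorem effChar_den_pos {z : ℝ} (hz : 0 < z) (θ : ℝ) : 0 < z ^ 2 + 2 - 2 * Real.cos θ := by
  nlinarith [Real.cos_le_one θ]

theorem continuous_effChar {z : ℝ} (hz : 0 < z) : Continuous (effChar z) := by
  unfold effChar
  exact continuous_const.div (by fun_prop) fun θ => (effChar_den_pos hz θ).ne'

theorem effChar_pos {z : ℝ} (hz : 0 < z) (θ : ℝ) : 0 < effChar z θ :=
  div_pos (by positivity) (effChar_den_pos hz θ)

theorem weight_pos {lam : ℝ} (hlam : 0 < lam) (m : ℤ) : 0 < weight lam m := by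
  unfold weight; split_ifs <;> linarith

/-- Laziness enters here: it is what makes the row chain positive semidefinite at every frequency.
-/
theorem mass_add_four_le {z lam : ℝ} (hz : 0 < z) (hlam : 0 < lam) (θ : ℝ) (m : ℤ) :
    mass z lam θ m + 4 ≤ 2 * weight lam m := by
  have h1 := Real.sin_sq_le_one θ
  have h2 := effChar_pos hz θ
  unfold mass weight
  split_ifs
  · nlinarith
  · linarith

theorem continuous_mass {z : ℝ} (hz : 0 < z) (lam : ℝ) (m : ℤ) :
    Continuous fun θ => mass z lam θ m := by
  have := continuous_effChar hz
  unfold mass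
  split_ifs <;> fun_prop

theorem continuous_rowKernel {z lam : ℝ} (hz : 0 < z) (t : ℕ) (m n : ℤ) :
    Continuous fun θ => rowKernel (weight lam) (mass z lam θ) t m n := by
  induction t generalizing m with
  | zero => simp only [rowKernel_zero]; exact continuous_const
  | succ t ih =>
    simp only [rowKernel_succ, rowOp]
    have h1 := ih m
    have h2 := ih (m + 1)
    have h3 := ih (m - 1)
    have h4 := continuous_mass hz lam m
    fun_prop

/-! ### One step of the walk as a sum over neighbours -/

theorem conductance_eq (z lam : ℝ) (u m : ℤ) (w : Vertex) :
    conductance z lam (u, m) w = (if w = (u, m + 1) then 1 else 0)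
      + (if w = (u, m - 1) then 1 else 0)
      + if w.2 = m then rowConductance z lam m (w.1 - u) else 0 := by
  obtain ⟨v, l⟩ := w
  simp only [conductance, rowConductance, Prod.mk.injEq]
  have e1 : (u - v).natAbs = (v - u).natAbs := by omega
  rw [e1]
  by_cases hl : l = m
  · subst hl
    have h2 : ¬ l = l - 1 := by omega
    simp [h2]
    split_ifs <;> ring
  · have h1 : ¬ m = l := fun h => hl h.symm
    simp only [hl, h1, if_false, add_zero]
    by_cases hv : u = v
    · subst hv
      by_cases ha : l = m + 1
      · subst ha; simp; omega
      · by_cases hb : l = m - 1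
        · subst hb; simp; omega
        · have : ¬ (m - l).natAbs = 1 := by omega
          simp [ha, hb, this]
    · have hv' : ¬ v = u := fun h => hv h.symm
      simp [hv, hv']

theorem hasSum_rowConductance {z lam : ℝ} {u m : ℤ} {F : Vertex → ℝ} {S : ℝ}
    (hS : HasSum (fun k : ℤ => effWeight z k * F (u + k, 0)) S) :
    HasSum (fun k : ℤ => rowConductance z lam m k * F (u + k, m))
      ((if m = 0 then lam else 1) * (F (u + 2, m) + F (u - 2, m))
        + if m = 0 then lam * S else 0) := by
  have h1 : HasSum (fun k : ℤ => (if k.natAbs = 2 then 1 else 0) * F (u + k, m))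
      (F (u + 2, m) + F (u - 2, m)) := by
    have := (hasSum_ite_eq (2 : ℤ) (F (u + 2, m))).add (hasSum_ite_eq (-2 : ℤ) (F (u - 2, m)))
    refine this.congr_fun fun k => ?_
    by_cases h2 : k = 2
    · subst h2; simp
    · by_cases h3 : k = -2
      · subst h3; simp [sub_eq_add_neg]
      · have : ¬ k.natAbs = 2 := by omega
        simp [h2, h3, this]
  by_cases hm : m = 0
  · subst hm
    simp only [rowConductance, if_true]
    refine ((h1.mul_left lam).add (hS.mul_left lam)).congr_fun fun k => ?_
    rw [add_mul, mul_assoc, mul_assoc]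
  · simp only [rowConductance, hm, if_false, add_zero, one_mul]
    exact h1

/-- The sum `S` of the infinite-range part is left as data: `F = 1` gives the total conductance, and
transition probabilities as `F` give a step of the walk. -/
theorem hasSum_conductance {z lam : ℝ} {u m : ℤ} {F : Vertex → ℝ} {S : ℝ}
    (hS : HasSum (fun k : ℤ => effWeight z k * F (u + k, 0)) S) :
    HasSum (fun w => conductance z lam (u, m) w * F w)
      (F (u, m + 1) + F (u, m - 1) + ((if m = 0 then lam else 1) * (F (u + 2, m) + F (u - 2, m))
        + if m = 0 then lam * S else 0)) := by
  have hinj : Function.Injective fun k : ℤ => ((u + k, m) : Vertex) := fun a b h => by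
    simpa using h
  have h3 : HasSum (fun w : Vertex =>
      (if w.2 = m then rowConductance z lam m (w.1 - u) else 0) * F w)
      ((if m = 0 then lam else 1) * (F (u + 2, m) + F (u - 2, m))
        + if m = 0 then lam * S else 0) := by
    refine (hinj.hasSum_iff ?_).mp ((hasSum_rowConductance (m := m) hS).congr_fun fun k => ?_)
    · intro w hw
      have : ¬ w.2 = m := fun h => hw ⟨w.1 - u, by simp [← h]⟩
      simp [this]
    · simp
  refine (((hasSum_ite_eq ((u, m + 1) : Vertex) (F (u, m + 1))).add
    (hasSum_ite_eq ((u, m - 1) : Vertex) (F (u, m - 1)))).add h3).congr_fun fun w => ?_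
  rw [conductance_eq, add_mul, add_mul]
  congr 2
  · split_ifs with h <;> simp [h]
  · split_ifs with h <;> simp [h]

theorem tsum_conductance {z : ℝ} (hz : 0 < z) (lam : ℝ) (x : Vertex) :
    ∑' w, conductance z lam x w = weight lam x.2 := by
  obtain ⟨u, m⟩ := x
  have h := hasSum_conductance (z := z) (lam := lam) (u := u) (m := m) (F := fun _ => 1) (S := 1)
    (by simpa using hasSum_effWeight hz)
  simp only [mul_one] at h
  rw [h.tsum_eq, weight]
  split_ifs <;> ring

theorem hasSum_lazyStep {z lam : ℝ} (hz : 0 < z) {u m : ℤ} {F : Vertex → ℝ} {S : ℝ}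
    (hS : HasSum (fun k : ℤ => effWeight z k * F (u + k, 0)) S) :
    HasSum (fun w => lazyStep z lam (u, m) w * F w)
      ((F (u, m) + (F (u, m + 1) + F (u, m - 1)
        + ((if m = 0 then lam else 1) * (F (u + 2, m) + F (u - 2, m))
        + if m = 0 then lam * S else 0)) / weight lam m) / 2) := by
  refine (((hasSum_ite_eq ((u, m) : Vertex) (F (u, m))).add
    ((hasSum_conductance hS).div_const (weight lam m))).div_const 2).congr_fun fun w => ?_
  rw [lazyStep, step, tsum_conductance hz]
  by_cases h : (u, m) = w
  · subst h; simp; ring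
  · have h' : ¬ w = (u, m) := fun e => h e.symm
    simp only [h, h', if_false]; ring

theorem hasSum_effWeight_mul_cosCoeff {z : ℝ} (hz : 0 < z) {f : ℝ → ℝ} (hf : Continuous f)
    (a : ℤ) : HasSum (fun k : ℤ => effWeight z k * cosCoeff f (a + k))
      (cosCoeff (fun θ => effChar z θ * f θ) a) := by
  have hc := continuous_effChar hz
  have main := hasSum_integral_Ioo (ι := ℤ)
    (F := fun k θ => effWeight z k * (Real.cos ((a + k : ℤ) * θ) * f θ))
    (f := fun θ => Real.cos (a * θ) * (effChar z θ * f θ))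
    (fun k θ => effWeight z k * |f θ|)
    (total := fun θ => 1 * |f θ|)
    (fun k => (by fun_prop : Continuous _).measurable)
    (fun k θ _ => by
      rw [abs_mul, abs_mul, abs_of_nonneg (effWeight_nonneg hz k)]
      have e1 := Real.abs_cos_le_one ((a + k : ℤ) * θ)
      refine mul_le_mul_of_nonneg_left ?_ (effWeight_nonneg hz k)
      exact mul_le_of_le_one_left (abs_nonneg _) e1)
    (fun θ _ => (hasSum_effWeight hz).mul_right _)
    (integrableOn_Ioo_of_continuous (by fun_prop))
    (fun θ _ => by
      have h := (hasSum_effWeight_mul_cos hz (a * θ) θ).mul_right (f θ)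
      have e : Real.cos (a * θ) * (effChar z θ * f θ)
          = z ^ 2 / (z ^ 2 + 2 - 2 * Real.cos θ) * Real.cos (a * θ) * f θ := by
        rw [effChar]; ring
      rw [e]
      refine h.congr_fun fun k => ?_
      push_cast
      rw [add_mul]; ring)
  refine (main.mul_left (1 / Real.pi)).congr_fun fun k => ?_
  rw [integral_const_mul, cosCoeff]
  ring

/-- Induction on time: symmetric horizontal jumps become multipliers, which go into the diagonal of
the row operator, while vertical jumps remain. -/
theorem lazyProb_eq {z lam : ℝ} (hz : 0 < z) (hlam : 0 < lam) (t : ℕ) (x o : Vertex) :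
    lazyProb z lam t x o
      = cosCoeff (fun θ => rowKernel (weight lam) (mass z lam θ) t x.2 o.2) (x.1 - o.1) := by
  induction t generalizing x with
  | zero =>
    obtain ⟨u, m⟩ := x
    obtain ⟨v, n⟩ := o
    simp only [lazyProb, rowKernel_zero, Prod.mk.injEq]
    by_cases h : m = n
    · simp [h, cosCoeff_one, sub_eq_zero]
    · simp [h, cosCoeff]
  | succ t ih =>
    obtain ⟨u, m⟩ := x
    have hk := fun l => continuous_rowKernel (lam := lam) hz t l o.2
    set K : ℤ → ℝ → ℝ := fun l θ => rowKernel (weight lam) (mass z lam θ) t l o.2 with hK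
    have hkm := hk m
    have hkm1 := hk (m + 1)
    have hkm2 := hk (m - 1)
    have hch := continuous_effChar hz
    have hS : HasSum (fun k : ℤ => effWeight z k * lazyProb z lam t (u + k, 0) o)
        (cosCoeff (fun θ => effChar z θ * K 0 θ) (u - o.1)) := by
      refine (hasSum_effWeight_mul_cosCoeff hz (hk 0) (u - o.1)).congr_fun fun k => ?_
      rw [ih]
      congr 2
      ring
    rw [lazyProb, (hasSum_lazyStep (lam := lam) (m := m) (F := fun w => lazyProb z lam t w o) hz
      hS).tsum_eq]
    simp only [ih]
    have hW := (weight_pos hlam m).ne'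
    have hshift := cosCoeff_shift (hk m) (u - o.1) 2
    rw [show u - o.1 - 2 = u - 2 - o.1 by ring, show u - o.1 + 2 = u + 2 - o.1 by ring,
      add_comm] at hshift
    rw [hshift, ← cosCoeff_const_mul]
    have hlast : (if m = 0 then lam * cosCoeff (fun θ => effChar z θ * K 0 θ) (u - o.1) else 0)
        = cosCoeff (fun θ => (if m = 0 then lam else 0) * (effChar z θ * K m θ)) (u - o.1) := by
      rw [cosCoeff_const_mul]
      split_ifs with h
      · rw [h]
      · simp
    rw [hlast]
    -- The diagonal 2 W - 2 - mass is W, from laziness, plus the multipliers of the jumps by ±2 and,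
    -- in row 0, of the effective weights.
    have hdecomp : ∀ θ, rowKernel (weight lam) (mass z lam θ) (t + 1) m o.2
        = 2⁻¹ * (K m θ + (weight lam m)⁻¹ * ((K (m + 1) θ + K (m - 1) θ)
          + ((if m = 0 then lam else 1) * (2 * Real.cos ((2 : ℤ) * θ) * K m θ)
            + (if m = 0 then lam else 0) * (effChar z θ * K m θ)))) := by
      intro θ
      rw [rowKernel_succ, rowOp]
      have hc2 : Real.cos (2 * θ) = 1 - 2 * Real.sin θ ^ 2 := by
        rw [Real.cos_two_mul, Real.cos_sq']; ring
      push_cast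
      rw [hc2]
      simp only [hK]
      field_simp
      unfold weight mass
      split_ifs <;> ring
    simp only [hdecomp]
    rw [cosCoeff_const_mul _ 2⁻¹, cosCoeff_add, cosCoeff_const_mul _ (weight lam m)⁻¹,
      cosCoeff_add, cosCoeff_add, cosCoeff_add, cosCoeff_const_mul _ (if m = 0 then lam else 1)]
    · ring
    all_goals fun_prop

/-! ### The Green function of the vertical chain at a fixed frequency -/

/-- The exponential decay rate per row at horizontal frequency `θ`. -/
noncomputable def decay (θ : ℝ) : ℝ := Real.exp (-(2 * Real.arsinh (Real.sin θ)))

/-- The conductance defect of the bottom row divided by `sin (θ / 2) ^ 2`. -/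
noncomputable def defect (z lam θ : ℝ) : ℝ :=
  16 * (lam - 1) * Real.cos (θ / 2) ^ 2 + 4 * lam / (z ^ 2 + 4 * Real.sin (θ / 2) ^ 2)

/-- The denominator of the reflection coefficient. -/
noncomputable def reflDen (z lam θ : ℝ) : ℝ :=
  8 * Real.cos (θ / 2) * √(1 + Real.sin θ ^ 2) + Real.sin (θ / 2) * defect z lam θ

/-- The reflection coefficient of the bottom row. -/
noncomputable def refl (z lam θ : ℝ) : ℝ :=
  Real.sin (θ / 2) * defect z lam θ / reflDen z lam θ

/-- The Green function of the vertical chain, for the sum of the conductances. -/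
noncomputable def green (z lam θ : ℝ) (m n : ℤ) : ℝ :=
  (decay θ ^ (m - n).natAbs - decay θ ^ m.natAbs * decay θ ^ n.natAbs * refl z lam θ)
    / (4 * Real.sin θ * √(1 + Real.sin θ ^ 2))

theorem decay_pos (θ : ℝ) : 0 < decay θ := Real.exp_pos _

theorem decay_le_one {θ : ℝ} (hθ : θ ∈ Set.Icc 0 Real.pi) : decay θ ≤ 1 := by
  rw [decay, Real.exp_le_one_iff]
  have := Real.arsinh_nonneg_iff.mpr (Real.sin_nonneg_of_mem_Icc hθ)
  linarith

theorem decay_quadratic (θ : ℝ) : decay θ ^ 2 + 1 = (2 + 4 * Real.sin θ ^ 2) * decay θ := by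
  have := exp_two_arsinh_quadratic (Real.sin θ)
  rw [← decay] at this
  linear_combination this

/-- With sinh u = sin θ, the Wronskian is 4 sinh u cosh u = e^{2u} - e^{-2u} = s⁻¹ - s. -/
theorem decay_mul_wronskian (θ : ℝ) :
    decay θ * (4 * Real.sin θ * √(1 + Real.sin θ ^ 2)) = 1 - decay θ ^ 2 := by
  have h1 := Real.sinh_arsinh (Real.sin θ)
  have h2 := Real.cosh_arsinh (Real.sin θ)
  rw [← h2]
  rw [Real.sinh_eq] at h1
  rw [Real.cosh_eq, decay]
  have h3 : Real.exp (-(2 * Real.arsinh (Real.sin θ)))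
      = Real.exp (-Real.arsinh (Real.sin θ)) ^ 2 := by
    rw [← Real.exp_nat_mul]; congr 1; push_cast; ring
  have h4 : Real.exp (Real.arsinh (Real.sin θ)) * Real.exp (-Real.arsinh (Real.sin θ)) = 1 := by
    rw [← Real.exp_add]; simp
  rw [h3]
  set a := Real.exp (Real.arsinh (Real.sin θ))
  set b := Real.exp (-Real.arsinh (Real.sin θ))
  linear_combination (a * b + 1) * h4 - 2 * b ^ 2 * (a + b) * h1

theorem sqrt_one_add_sin_sq_pos (θ : ℝ) : 0 < √(1 + Real.sin θ ^ 2) :=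
  Real.sqrt_pos.mpr (by positivity)

theorem sin_eq_half (θ : ℝ) : Real.sin θ = 2 * Real.sin (θ / 2) * Real.cos (θ / 2) := by
  rw [← Real.sin_two_mul]; congr 1; ring

theorem one_sub_effChar {z : ℝ} (hz : 0 < z) (θ : ℝ) :
    1 - effChar z θ = 4 * Real.sin (θ / 2) ^ 2 / (z ^ 2 + 4 * Real.sin (θ / 2) ^ 2) := by
  have h : 2 - 2 * Real.cos θ = 4 * Real.sin (θ / 2) ^ 2 := by
    have := Real.cos_sq' (θ / 2)
    have h2 := Real.cos_two_mul (θ / 2)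
    rw [show 2 * (θ / 2) = θ by ring] at h2
    linarith
  have hp : 0 < z ^ 2 + 4 * Real.sin (θ / 2) ^ 2 := by positivity
  rw [effChar, show z ^ 2 + 2 - 2 * Real.cos θ = z ^ 2 + 4 * Real.sin (θ / 2) ^ 2 by linarith]
  field_simp
  ring

/-- The Wronskian and the defect of row 0 share a factor sin (θ/2); dividing it out leaves a
denominator that is nonzero at both endpoints. -/
theorem sin_half_mul_reflDen (z lam θ : ℝ) :
    Real.sin (θ / 2) * reflDen z lam θ
      = 4 * Real.sin θ * √(1 + Real.sin θ ^ 2) + Real.sin (θ / 2) ^ 2 * defect z lam θ := by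
  rw [reflDen]
  linear_combination (-4 * √(1 + Real.sin θ ^ 2)) * sin_eq_half θ

theorem sin_half_sq_mul_defect {z : ℝ} (hz : 0 < z) (lam θ : ℝ) :
    Real.sin (θ / 2) ^ 2 * defect z lam θ
      = 4 * (lam - 1) * Real.sin θ ^ 2 + lam * (1 - effChar z θ) := by
  rw [one_sub_effChar hz, defect, sin_eq_half θ]
  ring

/-- A form in which positivity is visible even when lam < 1 and the defect may be negative. -/
theorem sin_half_mul_reflDen' {z : ℝ} (hz : 0 < z) (lam θ : ℝ) :
    Real.sin (θ / 2) * reflDen z lam θ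
      = 2 * (1 - decay θ) + lam * (4 * Real.sin θ ^ 2 + (1 - effChar z θ)) := by
  have h1 := decay_mul_wronskian θ
  have h2 := decay_quadratic θ
  have h3 := (decay_pos θ).ne'
  rw [sin_half_mul_reflDen, sin_half_sq_mul_defect hz]
  have h4 : 4 * Real.sin θ * √(1 + Real.sin θ ^ 2) = 2 + 4 * Real.sin θ ^ 2 - 2 * decay θ := by
    apply mul_left_cancel₀ h3
    rw [h1]
    linear_combination h2
  rw [h4]
  ring

theorem sin_half_pos {θ : ℝ} (hθ : θ ∈ Set.Ioc 0 Real.pi) : 0 < Real.sin (θ / 2) :=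
  Real.sin_pos_of_pos_of_lt_pi (by linarith [hθ.1]) (by linarith [hθ.2, Real.pi_pos])

theorem one_sub_effChar_pos {z θ : ℝ} (hz : 0 < z) (hθ : θ ∈ Set.Ioc 0 Real.pi) :
    0 < 1 - effChar z θ := by
  have := sin_half_pos hθ
  rw [one_sub_effChar hz]
  positivity

theorem reflDen_pos {z lam θ : ℝ} (hz : 0 < z) (hlam : 0 < lam) (hθ : θ ∈ Set.Icc 0 Real.pi) :
    0 < reflDen z lam θ := by
  rcases hθ.1.eq_or_lt with h | h
  · rw [← h]; simp [reflDen]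
  · have hθ' : θ ∈ Set.Ioc 0 Real.pi := ⟨h, hθ.2⟩
    have h1 := sin_half_mul_reflDen' hz lam θ
    have h2 := decay_le_one hθ
    have h3 := one_sub_effChar_pos hz hθ'
    have h4 : 0 < Real.sin (θ / 2) * reflDen z lam θ := by
      rw [h1]
      have : 0 < lam * (4 * Real.sin θ ^ 2 + (1 - effChar z θ)) := by positivity
      linarith
    exact pos_of_mul_pos_right h4 (sin_half_pos hθ').le

theorem decay_green_equation (θ : ℝ) (j : ℤ) :
    (2 + 4 * Real.sin θ ^ 2) * decay θ ^ j.natAbs - decay θ ^ (j + 1).natAbs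
        - decay θ ^ (j - 1).natAbs
      = if j = 0 then 4 * Real.sin θ * √(1 + Real.sin θ ^ 2) else 0 := by
  have h1 := decay_mul_wronskian θ
  have h2 := decay_quadratic θ
  have h3 := (decay_pos θ).ne'
  split_ifs with h
  · subst h
    apply mul_left_cancel₀ h3
    rw [h1]
    simp
    linear_combination -h2
  · obtain ⟨k, rfl | rfl⟩ : ∃ k : ℕ, j = k + 1 ∨ j = -(k + 1) := by
      rcases lt_or_gt_of_ne h with h | h
      · exact ⟨(-j - 1).toNat, Or.inr (by omega)⟩
      · exact ⟨(j - 1).toNat, Or.inl (by omega)⟩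
    · rw [show ((k : ℤ) + 1).natAbs = k + 1 by omega, show ((k : ℤ) + 1 + 1).natAbs = k + 2 by omega,
        show ((k : ℤ) + 1 - 1).natAbs = k by omega]
      linear_combination (-decay θ ^ k) * h2
    · rw [show (-((k : ℤ) + 1)).natAbs = k + 1 by omega,
        show (-((k : ℤ) + 1) + 1).natAbs = k by omega,
        show (-((k : ℤ) + 1) - 1).natAbs = k + 2 by omega]
      linear_combination (-decay θ ^ k) * h2

/-- The matching condition V (w + d) = d, where d is the excess of the killing in row 0 over the
other rows. -/
theorem refl_mul {z lam θ : ℝ} (hz : 0 < z) (hlam : 0 < lam) (hθ : θ ∈ Set.Ioo 0 Real.pi) :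
    refl z lam θ * (4 * Real.sin θ * √(1 + Real.sin θ ^ 2)
        + (4 * (lam - 1) * Real.sin θ ^ 2 + lam * (1 - effChar z θ)))
      = 4 * (lam - 1) * Real.sin θ ^ 2 + lam * (1 - effChar z θ) := by
  have h := (reflDen_pos hz hlam ⟨hθ.1.le, hθ.2.le⟩).ne'
  rw [← sin_half_sq_mul_defect hz, ← sin_half_mul_reflDen, refl]
  field_simp

theorem wronskian_pos {θ : ℝ} (hθ : θ ∈ Set.Ioo 0 Real.pi) :
    0 < 4 * Real.sin θ * √(1 + Real.sin θ ^ 2) := by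
  have := Real.sin_pos_of_mem_Ioo hθ
  have := sqrt_one_add_sin_sq_pos θ
  positivity

/-- The first term of `green` solves the homogeneous chain. In row 0 the excess d leaves d (1 - V)
s^|n|, which the jump V w s^|n| of the reflected term compensates. -/
theorem green_equation {z lam θ : ℝ} (hz : 0 < z) (hlam : 0 < lam)
    (hθ : θ ∈ Set.Ioo 0 Real.pi) (m n : ℤ) :
    (2 + mass z lam θ m) * green z lam θ m n
        - (green z lam θ (m + 1) n + green z lam θ (m - 1) n) = if m = n then 1 else 0 := by
  have hw := (wronskian_pos hθ).ne'
  have hr := refl_mul hz hlam hθ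
  have h1 := decay_green_equation θ m
  have h2 := decay_green_equation θ (m - n)
  rw [show m - n + 1 = m + 1 - n by ring, show m - n - 1 = m - 1 - n by ring] at h2
  simp only [green]
  set w := 4 * Real.sin θ * √(1 + Real.sin θ ^ 2)
  set V := refl z lam θ
  set s := decay θ
  by_cases hm : m = 0
  · subst hm
    simp only [mass, if_true, sub_eq_zero] at h1 h2 ⊢
    have goal' : (2 + lam * (4 * Real.sin θ ^ 2 + (1 - effChar z θ)))
        * (s ^ (0 - n).natAbs - s ^ (0 : ℤ).natAbs * s ^ n.natAbs * V)
        - (s ^ (0 + 1 - n).natAbs - s ^ (0 + 1 : ℤ).natAbs * s ^ n.natAbs * V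
          + (s ^ (0 - 1 - n).natAbs - s ^ (0 - 1 : ℤ).natAbs * s ^ n.natAbs * V))
        = if 0 = n then w else 0 := by
      rw [← h2]
      rw [show (0 - n).natAbs = n.natAbs by omega]
      simp only [Int.natAbs_zero, pow_zero] at h1 ⊢
      linear_combination (-s ^ n.natAbs * V) * h1 - s ^ n.natAbs * hr
    rw [← mul_div_assoc, ← add_div, ← sub_div, goal']
    split_ifs
    · exact div_self hw
    · exact zero_div _
  · simp only [mass, hm, if_false, sub_eq_zero] at h1 h2 ⊢
    have goal' : (2 + 4 * Real.sin θ ^ 2)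
        * (s ^ (m - n).natAbs - s ^ m.natAbs * s ^ n.natAbs * V)
        - (s ^ (m + 1 - n).natAbs - s ^ (m + 1).natAbs * s ^ n.natAbs * V
          + (s ^ (m - 1 - n).natAbs - s ^ (m - 1).natAbs * s ^ n.natAbs * V))
        = if m = n then w else 0 := by
      rw [← h2]
      linear_combination (-s ^ n.natAbs * V) * h1
    rw [← mul_div_assoc, ← add_div, ← sub_div, goal']
    split_ifs
    · exact div_self hw
    · exact zero_div _

/-- The powers of the vertical chain sum to the explicit Green function. -/
theorem hasSum_rowKernel_green {z lam θ : ℝ} (hz : 0 < z) (hlam : 0 < lam)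
    (hθ : θ ∈ Set.Ioo 0 Real.pi) (m n : ℤ) :
    HasSum (fun t => rowKernel (weight lam) (mass z lam θ) t m n)
      (2 * weight lam n * green z lam θ m n) := by
  have hs := Real.sin_pos_of_mem_Ioo hθ
  have hp := one_sub_effChar_pos hz ⟨hθ.1, hθ.2.le⟩
  have hw := wronskian_pos hθ
  have hd := decay_le_one (θ := θ) ⟨hθ.1.le, hθ.2.le⟩
  have hd0 := decay_pos θ
  have hpow : ∀ k : ℕ, decay θ ^ k ≤ 1 := fun k => pow_le_one₀ hd0.le hd
  refine hasSum_rowKernel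
    -- The smaller of the killing ratios mass / (2 W) off and on row 0.
    (δ := min (4 * Real.sin θ ^ 2 / 8)
      (lam * (4 * Real.sin θ ^ 2 + (1 - effChar z θ)) / (2 * (2 + 3 * lam))))
    (B := 2 * weight lam n * ((1 + |refl z lam θ|) / (4 * Real.sin θ * √(1 + Real.sin θ ^ 2))))
    (g := fun m => 2 * weight lam n * green z lam θ m n)
    (weight_pos hlam) (mass_add_four_le hz hlam θ) ?_ ?_ ?_ ?_ m
  · intro m
    unfold weight mass
    split_ifs
    · calc _ ≤ 2 * (2 + 3 * lam) *
          (lam * (4 * Real.sin θ ^ 2 + (1 - effChar z θ)) / (2 * (2 + 3 * lam))) :=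
            mul_le_mul_of_nonneg_left (min_le_right _ _) (by positivity)
        _ = _ := by field_simp
    · calc _ ≤ 2 * 4 * (4 * Real.sin θ ^ 2 / 8) :=
            mul_le_mul_of_nonneg_left (min_le_left _ _) (by positivity)
        _ = _ := by ring
  · exact lt_min (by positivity) (by positivity)
  · intro m
    have hW := weight_pos hlam n
    rw [abs_mul, abs_of_pos (by positivity : 0 < 2 * weight lam n), green, abs_div, abs_of_pos hw]
    gcongr
    refine (abs_sub _ _).trans (add_le_add ?_ ?_)
    · rw [abs_of_pos (by positivity)]; exact hpow _
    · rw [abs_mul, abs_of_pos (by positivity : 0 < decay θ ^ m.natAbs * decay θ ^ n.natAbs)]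
      exact mul_le_of_le_one_left (abs_nonneg _)
        (mul_le_one₀ (hpow _) (by positivity) (hpow _))
  · intro m
    have h := green_equation hz hlam hθ m n
    have e : (2 + mass z lam θ m) * (2 * weight lam n * green z lam θ m n)
        - (2 * weight lam n * green z lam θ (m + 1) n + 2 * weight lam n * green z lam θ (m - 1) n)
        = 2 * weight lam n * ((2 + mass z lam θ m) * green z lam θ m n
        - (green z lam θ (m + 1) n + green z lam θ (m - 1) n)) := by ring
    rw [e, h]
    split_ifs with hmn
    · rw [hmn, mul_one]
    · rw [mul_zero]

/-- From row 0 the Green function stays bounded at θ = π, since the effective weights kill there;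
only the zero of sin (θ/2) at 0 has to be cancelled. -/
theorem green_bottom {z lam θ : ℝ} (hz : 0 < z) (hlam : 0 < lam)
    (hθ : θ ∈ Set.Ioo 0 Real.pi) (n : ℤ) :
    Real.sin (θ / 2) * green z lam θ 0 n = decay θ ^ n.natAbs / reflDen z lam θ := by
  have h := (reflDen_pos hz hlam ⟨hθ.1.le, hθ.2.le⟩).ne'
  have hw := (wronskian_pos hθ).ne'
  have h1 := sin_half_mul_reflDen z lam θ
  rw [green, refl, show (0 - n).natAbs = n.natAbs by omega, Int.natAbs_zero, pow_zero, one_mul]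
  rw [← mul_div_assoc, div_eq_div_iff hw h]
  field_simp
  linear_combination decay θ ^ n.natAbs * h1

theorem sin_mul_green {z lam θ : ℝ} (hθ : θ ∈ Set.Ioo 0 Real.pi) (m n : ℤ) :
    Real.sin θ * green z lam θ m n
      = decay θ ^ (m - n).natAbs * (4 * √(1 + Real.sin θ ^ 2))⁻¹
        - decay θ ^ (m.natAbs + n.natAbs) * (refl z lam θ * (4 * √(1 + Real.sin θ ^ 2))⁻¹) := by
  have h1 := (Real.sin_pos_of_mem_Ioo hθ).ne'
  have h2 := (sqrt_one_add_sin_sq_pos θ).ne'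
  rw [green, pow_add]
  field_simp

/-- The sign of the decrease of `|j|` powers from `j` to `j + 1`. -/
def stepSign (j : ℤ) : ℝ := if 0 ≤ j then 1 else -1

theorem abs_stepSign (j : ℤ) : |stepSign j| = 1 := by
  unfold stepSign; split_ifs <;> simp

theorem decay_pow_sub (θ : ℝ) (j : ℤ) :
    decay θ ^ j.natAbs - decay θ ^ (j + 1).natAbs
      = stepSign j * decay θ ^ (min j.natAbs (j + 1).natAbs) * (1 - decay θ) := by
  unfold stepSign
  split_ifs with h
  · rw [show min j.natAbs (j + 1).natAbs = j.natAbs by omega,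
      show (j + 1).natAbs = j.natAbs + 1 by omega]
    ring
  · rw [show min j.natAbs (j + 1).natAbs = (j + 1).natAbs by omega,
      show j.natAbs = (j + 1).natAbs + 1 by omega]
    ring

/-- The factor 1 - s of a vertical difference cancels the Wronskian at both endpoints. -/
theorem one_sub_decay_div {θ : ℝ} (hθ : θ ∈ Set.Ioo 0 Real.pi) :
    (1 - decay θ) / (4 * Real.sin θ * √(1 + Real.sin θ ^ 2)) = decay θ / (1 + decay θ) := by
  have h := decay_pos θ
  rw [div_eq_div_iff (wronskian_pos hθ).ne' (by positivity), decay_mul_wronskian]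
  ring

theorem green_sub {z lam θ : ℝ} (hθ : θ ∈ Set.Ioo 0 Real.pi) (m n : ℤ) :
    green z lam θ m n - green z lam θ (m + 1) n
      = stepSign (m - n) * (decay θ ^ (min (m - n).natAbs (m - n + 1).natAbs)
          * (decay θ / (1 + decay θ)))
        - stepSign m * (decay θ ^ (min m.natAbs (m + 1).natAbs + n.natAbs)
          * (refl z lam θ * (decay θ / (1 + decay θ)))) := by
  have h1 := decay_pow_sub θ (m - n)
  have h2 := decay_pow_sub θ m
  rw [← one_sub_decay_div hθ, green, green, ← sub_div, pow_add]
  rw [show m + 1 - n = m - n + 1 by ring]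
  linear_combination (h1 - decay θ ^ n.natAbs * refl z lam θ * h2)
    / (4 * Real.sin θ * √(1 + Real.sin θ ^ 2))

/-- Two differences give (1 - s)² in the reflected term, so the energy of a vertical dipole stays
bounded up to both endpoints. -/
theorem green_dipole {z lam θ : ℝ} (hθ : θ ∈ Set.Ioo 0 Real.pi) (m : ℤ) :
    green z lam θ m m + green z lam θ (m + 1) (m + 1) - green z lam θ m (m + 1)
        - green z lam θ (m + 1) m
      = decay θ / (1 + decay θ) * (2 - (decay θ ^ (min m.natAbs (m + 1).natAbs)) ^ 2
        * (1 - decay θ) * refl z lam θ) := by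
  have h2 := decay_pow_sub θ m
  have h3 : stepSign m ^ 2 = 1 := by rw [← sq_abs, abs_stepSign, one_pow]
  rw [← one_sub_decay_div hθ]
  simp only [green]
  rw [show (m - m).natAbs = 0 by omega, show (m + 1 - (m + 1)).natAbs = 0 by omega,
    show (m - (m + 1)).natAbs = 1 by omega, show (m + 1 - m).natAbs = 1 by omega]
  set A := decay θ ^ m.natAbs
  set B := decay θ ^ (m + 1).natAbs
  set Q := decay θ ^ (min m.natAbs (m + 1).natAbs)
  have h4 : (A - B) ^ 2 = Q ^ 2 * (1 - decay θ) ^ 2 := by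
    rw [h2, mul_pow, mul_pow, h3, one_mul]
  rw [pow_zero, pow_one]
  linear_combination (-refl z lam θ) * h4 / (4 * Real.sin θ * √(1 + Real.sin θ ^ 2))

/-! ### Oscillatory integrals -/

theorem half_le_arsinh {x : ℝ} (h0 : 0 ≤ x) (h1 : x ≤ 1) : x / 2 ≤ Real.arsinh x := by
  have hs : 1 ≤ √(1 + x ^ 2) := Real.one_le_sqrt.mpr (by nlinarith)
  calc x / 2 ≤ 1 - (1 + x)⁻¹ := by
        rw [show 1 - (1 + x)⁻¹ = x / (1 + x) by field_simp; ring]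
        exact div_le_div_of_nonneg_left h0 (by linarith) (by linarith)
    _ ≤ Real.log (1 + x) := Real.one_sub_inv_le_log_of_pos (by linarith)
    _ ≤ Real.arsinh x := by
        rw [Real.arsinh]
        exact Real.log_le_log (by linarith) (by linarith)

theorem decay_le_exp {θ : ℝ} (hθ : θ ∈ Set.Icc 0 Real.pi) :
    decay θ ≤ Real.exp (-Real.sin θ) := by
  rw [decay, Real.exp_le_exp]
  linarith [half_le_arsinh (Real.sin_nonneg_of_mem_Icc hθ) (Real.sin_le_one θ)]

theorem half_min_le_sin {θ : ℝ} (hθ : θ ∈ Set.Icc 0 Real.pi) :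
    θ / 2 ≤ Real.sin θ ∨ (Real.pi - θ) / 2 ≤ Real.sin θ := by
  have hpi := Real.pi_pos
  have hc : (1 : ℝ) / 2 ≤ 2 / Real.pi := by
    rw [div_le_div_iff₀ two_pos hpi]; linarith [Real.pi_le_four]
  rcases le_total θ (Real.pi / 2) with h | h
  · left
    have := Real.mul_le_sin hθ.1 h
    nlinarith [hθ.1]
  · right
    have := Real.mul_le_sin (x := Real.pi - θ) (by linarith [hθ.2]) (by linarith)
    rw [Real.sin_pi_sub] at this
    nlinarith [hθ.2]

theorem decay_pow_le {θ : ℝ} (hθ : θ ∈ Set.Icc 0 Real.pi) (M : ℕ) :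
    decay θ ^ M ≤ 3 * (Real.exp (-((M + 1) / 2) * θ)
      + Real.exp (-((M + 1) / 2) * (Real.pi - θ))) := by
  have h1 := decay_le_exp hθ
  -- The price of replacing M by M + 1 in the exponent, so that the bound also covers M = 0.
  have he : Real.exp (Real.sin θ) ≤ 3 :=
    (Real.exp_le_exp.mpr (Real.sin_le_one θ)).trans Real.exp_one_lt_three.le
  have hM : (0 : ℝ) ≤ M + 1 := by positivity
  have key : Real.exp (-((M + 1) * Real.sin θ)) ≤ Real.exp (-((M + 1) / 2) * θ)
      + Real.exp (-((M + 1) / 2) * (Real.pi - θ)) := by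
    rcases half_min_le_sin hθ with h | h
    · refine (Real.exp_le_exp.mpr ?_).trans (le_add_of_nonneg_right (Real.exp_pos _).le)
      nlinarith
    · refine (Real.exp_le_exp.mpr ?_).trans (le_add_of_nonneg_left (Real.exp_pos _).le)
      nlinarith
  calc decay θ ^ M ≤ Real.exp (-Real.sin θ) ^ M := pow_le_pow_left₀ (decay_pos θ).le h1 M
    _ = Real.exp (Real.sin θ) * Real.exp (-((M + 1) * Real.sin θ)) := by
        rw [← Real.exp_nat_mul, ← Real.exp_add]; congr 1; ring
    _ ≤ _ := mul_le_mul he key (Real.exp_pos _).le (by norm_num)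

theorem integral_exp_neg_mul_le {c : ℝ} (hc : 0 < c) :
    ∫ θ in (0 : ℝ)..Real.pi, Real.exp (-c * θ) ≤ 1 / c := by
  rw [intervalIntegral.integral_comp_mul_left (fun x => Real.exp x) (neg_ne_zero.mpr hc.ne'),
    integral_exp]
  simp only [mul_zero, Real.exp_zero, smul_eq_mul]
  rw [one_div, inv_neg, neg_mul, ← mul_neg, neg_sub]
  exact mul_le_of_le_one_right (by positivity) (by linarith [Real.exp_pos (-c * Real.pi)])

theorem integral_exp_neg_mul_sub_le {c : ℝ} (hc : 0 < c) :
    ∫ θ in (0 : ℝ)..Real.pi, Real.exp (-c * (Real.pi - θ)) ≤ 1 / c := by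
  rw [intervalIntegral.integral_comp_sub_left (fun x => Real.exp (-c * x))]
  simpa using integral_exp_neg_mul_le hc

theorem continuous_decay : Continuous decay := by
  unfold decay
  have := Real.continuous_arsinh
  fun_prop

theorem integral_decay_pow_le (M : ℕ) :
    ∫ θ in (0 : ℝ)..Real.pi, decay θ ^ M ≤ 12 / (M + 1) := by
  have hpi := Real.pi_pos
  have hc : (0 : ℝ) < (M + 1) / 2 := by positivity
  have hd := continuous_decay
  calc ∫ θ in (0 : ℝ)..Real.pi, decay θ ^ M
      ≤ ∫ θ in (0 : ℝ)..Real.pi, 3 * (Real.exp (-((M + 1) / 2) * θ)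
      + Real.exp (-((M + 1) / 2) * (Real.pi - θ))) :=
        intervalIntegral.integral_mono_on hpi.le
          (Continuous.intervalIntegrable (by fun_prop) _ _)
          (Continuous.intervalIntegrable (by fun_prop) _ _) fun θ hθ => decay_pow_le hθ M
    _ = 3 * ((∫ θ in (0 : ℝ)..Real.pi, Real.exp (-((M + 1) / 2) * θ))
        + ∫ θ in (0 : ℝ)..Real.pi, Real.exp (-((M + 1) / 2) * (Real.pi - θ))) := by
        rw [intervalIntegral.integral_const_mul, intervalIntegral.integral_add
          (Continuous.intervalIntegrable (by fun_prop) _ _)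
          (Continuous.intervalIntegrable (by fun_prop) _ _)]
    _ ≤ 3 * (1 / ((M + 1) / 2) + 1 / ((M + 1) / 2)) := by
        gcongr
        · exact integral_exp_neg_mul_le hc
        · exact integral_exp_neg_mul_sub_le hc
    _ = _ := by field_simp; norm_num

theorem hasDerivAt_decay (θ : ℝ) :
    HasDerivAt decay (decay θ * (-(2 * ((√(1 + Real.sin θ ^ 2))⁻¹ * Real.cos θ)))) θ :=
  (((Real.hasDerivAt_sin θ).arsinh.const_mul 2).neg).exp

theorem abs_integral_decay_pow_mul_le {B : ℝ} {g : ℝ → ℝ} (hB : 0 ≤ B)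
    (hg : ∀ θ ∈ Set.Icc 0 Real.pi, |g θ| ≤ B) (M : ℕ) :
    |∫ θ in (0 : ℝ)..Real.pi, decay θ ^ M * g θ| ≤ B * (12 / (M + 1)) := by
  have hpi := Real.pi_pos
  have hd := continuous_decay
  rw [← Real.norm_eq_abs]
  calc _ ≤ ∫ θ in (0 : ℝ)..Real.pi, B * decay θ ^ M :=
        intervalIntegral.norm_integral_le_of_norm_le hpi.le
          (ae_of_all _ fun θ hθ => by
            rw [Real.norm_eq_abs, abs_mul, abs_of_pos (pow_pos (decay_pos θ) M), mul_comm]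
            exact mul_le_mul_of_nonneg_right (hg θ ⟨hθ.1.le, hθ.2⟩) (pow_pos (decay_pos θ) M).le)
          (Continuous.intervalIntegrable (by fun_prop) _ _)
    _ ≤ _ := by
        rw [intervalIntegral.integral_const_mul]
        exact mul_le_mul_of_nonneg_left (integral_decay_pow_le M) hB

/-- Integration by parts. Differentiating `decay θ ^ M` costs a factor M, which the O(1/(M+1))
integral of that power absorbs, so the bound is uniform in M. The boundary terms give 2B/k and the
integral 24B/k. -/
theorem abs_integral_deriv_mul_decay_pow_le {B k : ℝ} {g g' T S : ℝ → ℝ} (hB : 0 ≤ B) (hk : 0 < k)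
    (hg : ∀ θ ∈ Set.Icc 0 Real.pi, |g θ| ≤ B) (hg' : ∀ θ ∈ Set.Icc 0 Real.pi, |g' θ| ≤ B)
    (hderiv : ∀ θ ∈ Set.Icc 0 Real.pi, HasDerivAt g (g' θ) θ)
    (hcont : ContinuousOn g' (Set.Icc 0 Real.pi)) (hT : Continuous T)
    (hS : ∀ θ, HasDerivAt S (T θ) θ) (hSk : ∀ θ, |S θ| ≤ 1 / k) (M : ℕ) :
    |∫ θ in (0 : ℝ)..Real.pi, T θ * (decay θ ^ M * g θ)| ≤ 38 * B / k := by
  have hpi := Real.pi_pos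
  have hd := continuous_decay
  have huIcc : Set.uIcc 0 Real.pi = Set.Icc 0 Real.pi := Set.uIcc_of_le hpi.le
  set q : ℝ → ℝ := fun θ => -(2 * ((√(1 + Real.sin θ ^ 2))⁻¹ * Real.cos θ)) with hq
  have hqc : Continuous q := by
    have : ∀ θ : ℝ, √(1 + Real.sin θ ^ 2) ≠ 0 := fun θ => (sqrt_one_add_sin_sq_pos θ).ne'
    fun_prop (disch := assumption)
  have hqb : ∀ θ, |q θ| ≤ 2 := by
    intro θ
    have h1 : 1 ≤ √(1 + Real.sin θ ^ 2) := Real.one_le_sqrt.mpr (by nlinarith [sq_nonneg (Real.sin θ)])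
    rw [hq, abs_neg, abs_mul, abs_two, abs_mul, abs_of_pos (by positivity)]
    have h2 := inv_le_one_of_one_le₀ h1
    have h3 := Real.abs_cos_le_one θ
    nlinarith [mul_le_one₀ h2 (abs_nonneg _) h3]
  set u' : ℝ → ℝ := fun θ => decay θ ^ M * (M * q θ * g θ + g' θ) with hu'
  have hu : ∀ θ ∈ Set.uIcc 0 Real.pi, HasDerivAt (fun θ => decay θ ^ M * g θ) (u' θ) θ := by
    intro θ hθ
    rw [huIcc] at hθ
    have h1 := ((hasDerivAt_decay θ).pow M).mul (hderiv θ hθ)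
    refine h1.congr_deriv ?_
    simp only [hu', hq, Pi.pow_apply]
    cases M with
    | zero => simp
    | succ n => simp only [Nat.add_sub_cancel, pow_succ]; push_cast; ring
  have hgc : ContinuousOn g (Set.Icc 0 Real.pi) := fun θ hθ =>
    (hderiv θ hθ).continuousAt.continuousWithinAt
  have hu'c : ContinuousOn u' (Set.uIcc 0 Real.pi) := by
    rw [huIcc]
    exact (hd.pow M).continuousOn.mul (((continuous_const.mul hqc).continuousOn.mul hgc).add hcont)
  have hparts := intervalIntegral.integral_mul_deriv_eq_deriv_mul hu (fun θ _ => hS θ)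
    hu'c.intervalIntegrable (hT.intervalIntegrable 0 Real.pi)
  have e1 : ∫ θ in (0 : ℝ)..Real.pi, T θ * (decay θ ^ M * g θ)
      = ∫ θ in (0 : ℝ)..Real.pi, decay θ ^ M * g θ * T θ :=
    intervalIntegral.integral_congr fun θ _ => by ring
  have e2 : ∫ θ in (0 : ℝ)..Real.pi, u' θ * S θ
      = ∫ θ in (0 : ℝ)..Real.pi, decay θ ^ M * ((M * q θ * g θ + g' θ) * S θ) :=
    intervalIntegral.integral_congr fun θ _ => by simp only [hu']; ring
  have hend : ∀ θ ∈ Set.Icc 0 Real.pi, |decay θ ^ M * g θ * S θ| ≤ B / k := by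
    intro θ hθ
    rw [abs_mul, abs_mul, abs_of_pos (pow_pos (decay_pos θ) M)]
    have h1 := pow_le_one₀ (n := M) (decay_pos θ).le (decay_le_one hθ)
    calc _ ≤ 1 * B * (1 / k) := by
          gcongr
          · exact hg θ hθ
          · exact hSk θ
      _ = _ := by ring
  have hint := abs_integral_decay_pow_mul_le (B := (2 * M + 1) * B / k)
    (g := fun θ => (M * q θ * g θ + g' θ) * S θ) (by positivity) (fun θ hθ => by
      rw [abs_mul]
      have h1 : |M * q θ * g θ + g' θ| ≤ M * 2 * B + B := by
        refine (abs_add_le _ _).trans (add_le_add ?_ (hg' θ hθ))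
        rw [abs_mul, abs_mul, Nat.abs_cast]
        gcongr
        · exact hqb θ
        · exact hg θ hθ
      calc _ ≤ (M * 2 * B + B) * (1 / k) := by
            gcongr
            exact hSk θ
        _ = _ := by ring) M
  have h0 := hend 0 ⟨le_rfl, hpi.le⟩
  have h1 := hend Real.pi ⟨hpi.le, le_rfl⟩
  rw [e1, hparts, e2]
  have hM : (0 : ℝ) ≤ M := Nat.cast_nonneg M
  have hfin : (2 * M + 1) * B / k * (12 / (M + 1)) ≤ 24 * (B / k) := by
    rw [show (2 * (M : ℝ) + 1) * B / k * (12 / (M + 1)) = ((2 * M + 1) * 12 / (M + 1)) * (B / k) by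
      ring]
    refine mul_le_mul_of_nonneg_right ?_ (by positivity)
    rw [div_le_iff₀ (by positivity)]
    linarith
  have hBk : 0 ≤ B / k := by positivity
  rw [show 38 * B / k = 38 * (B / k) by ring]
  have t1 := abs_sub (decay Real.pi ^ M * g Real.pi * S Real.pi - decay 0 ^ M * g 0 * S 0)
    (∫ θ in (0 : ℝ)..Real.pi, decay θ ^ M * ((M * q θ * g θ + g' θ) * S θ))
  have t2 := abs_sub (decay Real.pi ^ M * g Real.pi * S Real.pi) (decay 0 ^ M * g 0 * S 0)
  linarith

/-- Decay of the oscillatory integrals, in the frequency and in the power of `decay`. -/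
theorem exists_oscillatory_bound {g : ℝ → ℝ}
    (hg : ∀ θ ∈ Set.Icc 0 Real.pi, ContDiffAt ℝ 1 g θ) :
    ∃ C : ℝ, 0 < C ∧ ∀ (M : ℕ) (a : ℤ),
      |∫ θ in Set.Ioo 0 Real.pi, Real.cos (a * θ) * (decay θ ^ M * g θ)|
          * (1 + |(a : ℝ)| + M) ≤ C ∧
      |∫ θ in Set.Ioo 0 Real.pi, Real.sin (a * θ) * (decay θ ^ M * g θ)|
          * (1 + |(a : ℝ)| + M) ≤ C := by
  have hpi := Real.pi_pos
  have hc : ContinuousOn g (Set.Icc 0 Real.pi) := fun θ hθ =>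
    (hg θ hθ).continuousAt.continuousWithinAt
  have hc' : ContinuousOn (deriv g) (Set.Icc 0 Real.pi) := fun θ hθ =>
    (((hg θ hθ).continuousAt_fderiv one_ne_zero).clm_apply
      continuousAt_const).continuousWithinAt
  obtain ⟨B1, hB1⟩ := isCompact_Icc.exists_bound_of_continuousOn hc
  obtain ⟨B2, hB2⟩ := isCompact_Icc.exists_bound_of_continuousOn hc'
  set B := max (max B1 B2) 1
  have hB : 0 < B := lt_max_of_lt_right one_pos
  have hgB : ∀ θ ∈ Set.Icc 0 Real.pi, |g θ| ≤ B := fun θ hθ =>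
    (hB1 θ hθ).trans ((le_max_left _ _).trans (le_max_left _ _))
  have hgB' : ∀ θ ∈ Set.Icc 0 Real.pi, |deriv g θ| ≤ B := fun θ hθ =>
    (hB2 θ hθ).trans ((le_max_right _ _).trans (le_max_left _ _))
  have hderiv : ∀ θ ∈ Set.Icc 0 Real.pi, HasDerivAt g (deriv g θ) θ := fun θ hθ =>
    ((hg θ hθ).differentiableAt one_ne_zero).hasDerivAt
  have combine : ∀ (M : ℕ) (a : ℤ) (I : ℝ), I ≤ B * (12 / (M + 1)) → 0 ≤ I →
      (a ≠ 0 → I ≤ 38 * B / |(a : ℝ)|) → I * (1 + |(a : ℝ)| + M) ≤ 50 * B := by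
    intro M a I h1 h0 h2
    have hM : (0 : ℝ) ≤ M := Nat.cast_nonneg M
    have e1 : I * (M + 1) ≤ 12 * B := by
      rw [← le_div_iff₀ (by positivity)]
      exact h1.trans (le_of_eq (by ring))
    have e2 : I * |(a : ℝ)| ≤ 38 * B := by
      by_cases ha : a = 0
      · subst ha; simp; exact hB.le
      · rw [← le_div_iff₀ (by positivity)]
        exact h2 ha
    linarith
  have hsimple : ∀ (M : ℕ) (T : ℝ → ℝ), (∀ θ, |T θ| ≤ 1) →
      |∫ θ in (0 : ℝ)..Real.pi, T θ * (decay θ ^ M * g θ)| ≤ B * (12 / (M + 1)) := by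
    intro M T hT
    rw [intervalIntegral.integral_congr (g := fun θ => decay θ ^ M * (T θ * g θ))
      fun θ _ => by ring]
    refine abs_integral_decay_pow_mul_le hB.le (fun θ hθ => ?_) M
    rw [abs_mul]
    exact (mul_le_of_le_one_left (abs_nonneg _) (hT θ)).trans (hgB θ hθ)
  -- 50 = 12 + 38: the bounds on I (M + 1) and on I |a| are added.
  refine ⟨50 * B, by positivity, fun M a => ?_⟩
  rw [← integral_Ioc_eq_integral_Ioo, ← integral_Ioc_eq_integral_Ioo,
    ← intervalIntegral.integral_of_le hpi.le, ← intervalIntegral.integral_of_le hpi.le]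
  constructor
  · refine combine M a _ (hsimple M _ fun θ => Real.abs_cos_le_one _) (abs_nonneg _) fun ha => ?_
    have ha' : (a : ℝ) ≠ 0 := by exact_mod_cast ha
    refine abs_integral_deriv_mul_decay_pow_le (S := fun θ => Real.sin (a * θ) / a) hB.le
      (abs_pos.mpr ha') hgB hgB' hderiv hc' (by fun_prop) (fun θ => ?_) (fun θ => ?_) M
    · have := (((hasDerivAt_id θ).const_mul (a : ℝ)).sin).div_const (a : ℝ)
      refine this.congr_deriv ?_
      simp only [id]; field_simp
    · rw [abs_div]
      exact div_le_div_of_nonneg_right (Real.abs_sin_le_one _) (abs_nonneg _)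
  · refine combine M a _ (hsimple M _ fun θ => Real.abs_sin_le_one _) (abs_nonneg _) fun ha => ?_
    have ha' : (a : ℝ) ≠ 0 := by exact_mod_cast ha
    refine abs_integral_deriv_mul_decay_pow_le (S := fun θ => -(Real.cos (a * θ) / a)) hB.le
      (abs_pos.mpr ha') hgB hgB' hderiv hc' (by fun_prop) (fun θ => ?_) (fun θ => ?_) M
    · have := ((((hasDerivAt_id θ).const_mul (a : ℝ)).cos).div_const (a : ℝ)).neg
      refine this.congr_deriv ?_
      simp only [id]; field_simp
    · rw [abs_neg, abs_div]
      exact div_le_div_of_nonneg_right (Real.abs_cos_le_one _) (abs_nonneg _)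

/-! ### Regularity of the profiles -/

theorem contDiff_sqrt_one_add_sin_sq : ContDiff ℝ 1 fun θ => √(1 + Real.sin θ ^ 2) :=
  contDiff_iff_contDiffAt.mpr fun θ =>
    ((contDiffAt_const.add (Real.contDiff_sin.contDiffAt.pow 2)).sqrt (by positivity))

theorem contDiff_decay : ContDiff ℝ 1 decay :=
  ((contDiff_const.mul (Real.contDiff_sin.arsinh)).neg).exp

theorem contDiffAt_refl {z lam θ : ℝ} (hz : 0 < z) (hlam : 0 < lam)
    (hθ : θ ∈ Set.Icc 0 Real.pi) : ContDiffAt ℝ 1 (refl z lam) θ := by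
  have hsin : ContDiff ℝ 1 fun θ : ℝ => Real.sin (θ / 2) :=
    Real.contDiff_sin.comp (contDiff_id.div_const 2)
  have hcos : ContDiff ℝ 1 fun θ : ℝ => Real.cos (θ / 2) :=
    Real.contDiff_cos.comp (contDiff_id.div_const 2)
  have hdef : ContDiff ℝ 1 (defect z lam) := by
    refine (contDiff_const.mul (hcos.pow 2)).add
      (contDiff_const.div (contDiff_const.add (contDiff_const.mul (hsin.pow 2))) fun θ => ?_)
    positivity
  have hden : ContDiff ℝ 1 (reflDen z lam) :=
    ((contDiff_const.mul hcos).mul contDiff_sqrt_one_add_sin_sq).add (hsin.mul hdef)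
  exact (hsin.mul hdef).contDiffAt.div hden.contDiffAt (reflDen_pos hz hlam hθ).ne'

theorem continuous_reflDen {z : ℝ} (hz : 0 < z) (lam : ℝ) : Continuous (reflDen z lam) := by
  unfold reflDen defect
  have : ∀ θ : ℝ, z ^ 2 + 4 * Real.sin (θ / 2) ^ 2 ≠ 0 := fun θ => by positivity
  fun_prop (disch := assumption)

theorem continuousOn_refl {z lam : ℝ} (hz : 0 < z) (hlam : 0 < lam) :
    ContinuousOn (refl z lam) (Set.Icc 0 Real.pi) := fun _ hθ =>
  (contDiffAt_refl hz hlam hθ).continuousAt.continuousWithinAt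

theorem contDiff_inv_four_mul_sqrt : ContDiff ℝ 1 fun θ => (4 * √(1 + Real.sin θ ^ 2))⁻¹ :=
  (contDiff_const.mul contDiff_sqrt_one_add_sin_sq).inv fun θ => by
    have := sqrt_one_add_sin_sq_pos θ
    positivity

theorem contDiff_decay_div : ContDiff ℝ 1 fun θ => decay θ / (1 + decay θ) :=
  contDiff_decay.div (contDiff_const.add contDiff_decay) fun θ => by
    have := decay_pos θ
    positivity

theorem integrableOn_Ioo_of_continuousOn {f : ℝ → ℝ} (hf : ContinuousOn f (Set.Icc 0 Real.pi)) :
    IntegrableOn f (Set.Ioo 0 Real.pi) :=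
  hf.integrableOn_Icc.mono_set Set.Ioo_subset_Icc_self

/-! ### Integrated gradients of the Green function -/

/-- The two terms are the direct and the reflected one. The latter has the larger exponent N, hence
the better decay, and is weakened to M. -/
theorem exists_integral_sub_le {g h : ℝ → ℝ}
    (hg : ∀ θ ∈ Set.Icc 0 Real.pi, ContDiffAt ℝ 1 g θ)
    (hh : ∀ θ ∈ Set.Icc 0 Real.pi, ContDiffAt ℝ 1 h θ) :
    ∃ C : ℝ, 0 < C ∧ ∀ (M N : ℕ) (a : ℤ) (ε δ : ℝ), |ε| ≤ 2 → |δ| ≤ 2 → M ≤ N →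
      |∫ θ in Set.Ioo 0 Real.pi, Real.cos (a * θ) *
          (ε * (decay θ ^ M * g θ) - δ * (decay θ ^ N * h θ))| * (1 + |(a : ℝ)| + M) ≤ C ∧
      |∫ θ in Set.Ioo 0 Real.pi, Real.sin (a * θ) *
          (ε * (decay θ ^ M * g θ) - δ * (decay θ ^ N * h θ))| * (1 + |(a : ℝ)| + M) ≤ C := by
  obtain ⟨C, hC, hCb⟩ := exists_oscillatory_bound hg
  obtain ⟨D, hD, hDb⟩ := exists_oscillatory_bound hh
  have hgc : ContinuousOn g (Set.Icc 0 Real.pi) := fun θ hθ =>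
    (hg θ hθ).continuousAt.continuousWithinAt
  have hhc : ContinuousOn h (Set.Icc 0 Real.pi) := fun θ hθ =>
    (hh θ hθ).continuousAt.continuousWithinAt
  have hd := continuous_decay
  have split : ∀ (T : ℝ → ℝ) (M N : ℕ) (ε δ K : ℝ), Continuous T → |ε| ≤ 2 → |δ| ≤ 2 → 0 ≤ K →
      |∫ θ in Set.Ioo 0 Real.pi, T θ * (decay θ ^ M * g θ)| * K ≤ C →
      |∫ θ in Set.Ioo 0 Real.pi, T θ * (decay θ ^ N * h θ)| * K ≤ D →
      |∫ θ in Set.Ioo 0 Real.pi, T θ * (ε * (decay θ ^ M * g θ) - δ * (decay θ ^ N * h θ))| * K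
        ≤ 2 * C + 2 * D := by
    intro T M N ε δ K hT hε hδ hK h1 h2
    have i1 : IntegrableOn (fun θ => T θ * (decay θ ^ M * g θ)) (Set.Ioo 0 Real.pi) :=
      integrableOn_Ioo_of_continuousOn (hT.continuousOn.mul ((hd.pow M).continuousOn.mul hgc))
    have i2 : IntegrableOn (fun θ => T θ * (decay θ ^ N * h θ)) (Set.Ioo 0 Real.pi) :=
      integrableOn_Ioo_of_continuousOn (hT.continuousOn.mul ((hd.pow N).continuousOn.mul hhc))
    have e : ∫ θ in Set.Ioo 0 Real.pi,
        T θ * (ε * (decay θ ^ M * g θ) - δ * (decay θ ^ N * h θ))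
        = ε * (∫ θ in Set.Ioo 0 Real.pi, T θ * (decay θ ^ M * g θ))
          - δ * ∫ θ in Set.Ioo 0 Real.pi, T θ * (decay θ ^ N * h θ) := by
      rw [← integral_const_mul, ← integral_const_mul,
        ← integral_sub (i1.const_mul ε) (i2.const_mul δ)]
      congr 1
      ext θ
      ring
    rw [e]
    set I := ∫ θ in Set.Ioo 0 Real.pi, T θ * (decay θ ^ M * g θ)
    set J := ∫ θ in Set.Ioo 0 Real.pi, T θ * (decay θ ^ N * h θ)
    have h3 : |ε * I - δ * J| ≤ 2 * |I| + 2 * |J| := by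
      refine (abs_sub _ _).trans (add_le_add ?_ ?_)
      · rw [abs_mul]; gcongr
      · rw [abs_mul]; gcongr
    calc _ ≤ (2 * |I| + 2 * |J|) * K := by gcongr
      _ = 2 * (|I| * K) + 2 * (|J| * K) := by ring
      _ ≤ _ := by gcongr
  refine ⟨2 * C + 2 * D, by positivity, fun M N a ε δ hε hδ hMN => ?_⟩
  have hMN' : (M : ℝ) ≤ N := by exact_mod_cast hMN
  have weaken : ∀ I : ℝ, |I| * (1 + |(a : ℝ)| + N) ≤ D → |I| * (1 + |(a : ℝ)| + M) ≤ D :=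
    fun I hI => (mul_le_mul_of_nonneg_left (by linarith) (abs_nonneg I)).trans hI
  exact ⟨split _ M N ε δ _ (by fun_prop) hε hδ (by positivity) (hCb M a).1 (weaken _ (hDb N a).1),
    split _ M N ε δ _ (by fun_prop) hε hδ (by positivity) (hCb M a).2 (weaken _ (hDb N a).2)⟩

theorem cos_sub_cos_add_two (a θ : ℝ) :
    Real.cos (a * θ) - Real.cos ((a + 2) * θ) = 2 * Real.sin ((a + 1) * θ) * Real.sin θ := by
  rw [Real.cos_sub_cos, show (a * θ + (a + 2) * θ) / 2 = (a + 1) * θ by ring,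
    show (a * θ - (a + 2) * θ) / 2 = -θ by ring, Real.sin_neg]
  ring

theorem exists_horizontal_bound {z lam : ℝ} (hz : 0 < z) (hlam : 0 < lam) :
    ∃ C : ℝ, 0 < C ∧ ∀ a m n : ℤ,
      |∫ θ in Set.Ioo 0 Real.pi, (Real.cos (a * θ) - Real.cos ((a + 2 : ℤ) * θ))
        * green z lam θ m n| * (1 + |((a + 1 : ℤ) : ℝ)| + (m - n).natAbs) ≤ C := by
  obtain ⟨C, hC, hb⟩ := exists_integral_sub_le
    (g := fun θ => (4 * √(1 + Real.sin θ ^ 2))⁻¹)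
    (h := fun θ => refl z lam θ * (4 * √(1 + Real.sin θ ^ 2))⁻¹)
    (fun θ _ => contDiff_inv_four_mul_sqrt.contDiffAt)
    (fun θ hθ => (contDiffAt_refl hz hlam hθ).mul contDiff_inv_four_mul_sqrt.contDiffAt)
  refine ⟨C, hC, fun a m n => ?_⟩
  -- Both coefficients 2 come from cos (aθ) - cos ((a+2)θ) = 2 sin ((a+1)θ) sin θ; the sin θ is
  -- spent on the Wronskian.
  have h := (hb (m - n).natAbs (m.natAbs + n.natAbs) (a + 1) 2 2 (by simp) (by simp)
    (by omega)).2
  refine le_of_eq_of_le ?_ h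
  congr 2
  refine setIntegral_congr_fun measurableSet_Ioo fun θ hθ => ?_
  have e := sin_mul_green (z := z) (lam := lam) hθ m n
  have e2 := cos_sub_cos_add_two a θ
  push_cast
  rw [e2, mul_assoc, e]
  ring

theorem exists_vertical_bound {z lam : ℝ} (hz : 0 < z) (hlam : 0 < lam) :
    ∃ C : ℝ, 0 < C ∧ ∀ a m n : ℤ,
      |∫ θ in Set.Ioo 0 Real.pi, Real.cos (a * θ)
        * (green z lam θ m n - green z lam θ (m + 1) n)|
        * (1 + |(a : ℝ)| + (min (m - n).natAbs (m - n + 1).natAbs : ℕ)) ≤ C := by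
  obtain ⟨C, hC, hb⟩ := exists_integral_sub_le
    (g := fun θ => decay θ / (1 + decay θ))
    (h := fun θ => refl z lam θ * (decay θ / (1 + decay θ)))
    (fun θ _ => contDiff_decay_div.contDiffAt)
    (fun θ hθ => (contDiffAt_refl hz hlam hθ).mul contDiff_decay_div.contDiffAt)
  refine ⟨C, hC, fun a m n => ?_⟩
  have h := (hb (min (m - n).natAbs (m - n + 1).natAbs)
    (min m.natAbs (m + 1).natAbs + n.natAbs) a (stepSign (m - n)) (stepSign m)
    (by rw [abs_stepSign]; norm_num) (by rw [abs_stepSign]; norm_num) (by omega)).1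
  refine le_of_eq_of_le ?_ h
  congr 2
  refine setIntegral_congr_fun measurableSet_Ioo fun θ hθ => ?_
  rw [green_sub hθ]

/-! ### Summation in time -/

theorem hasSum_of_eq {f g : ℕ → ℝ} {a b : ℝ} (h : HasSum f a) (hfg : ∀ t, g t = f t)
    (hab : b = a) : HasSum g b :=
  hab ▸ h.congr_fun hfg

/-- Within one row both terms share the same nonnegative kernel, so the majorant sums exactly to the
Green function. -/
theorem hasSum_lazyProb_sub_row {z lam : ℝ} (hz : 0 < z) (hlam : 0 < lam) (u v m : ℤ)
    (o : Vertex)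
    (hi : IntegrableOn (fun θ => |Real.cos ((u - o.1 : ℤ) * θ) - Real.cos ((v - o.1 : ℤ) * θ)|
      * (2 * weight lam o.2 * green z lam θ m o.2)) (Set.Ioo 0 Real.pi)) :
    HasSum (fun t => lazyProb z lam t (u, m) o - lazyProb z lam t (v, m) o)
      (2 * weight lam o.2 / Real.pi * ∫ θ in Set.Ioo 0 Real.pi,
        (Real.cos ((u - o.1 : ℤ) * θ) - Real.cos ((v - o.1 : ℤ) * θ)) * green z lam θ m o.2) := by
  have hk := fun t => continuous_rowKernel (lam := lam) hz t m o.2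
  have main := hasSum_integral_Ioo (ι := ℕ)
    (F := fun t θ => (Real.cos ((u - o.1 : ℤ) * θ) - Real.cos ((v - o.1 : ℤ) * θ))
      * rowKernel (weight lam) (mass z lam θ) t m o.2)
    (f := fun θ => (Real.cos ((u - o.1 : ℤ) * θ) - Real.cos ((v - o.1 : ℤ) * θ))
      * (2 * weight lam o.2 * green z lam θ m o.2))
    (fun t θ => |Real.cos ((u - o.1 : ℤ) * θ) - Real.cos ((v - o.1 : ℤ) * θ)|
      * rowKernel (weight lam) (mass z lam θ) t m o.2)
    (fun t => by
      have := hk t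
      exact (by fun_prop : Continuous _).measurable)
    (fun t θ _ => by
      rw [abs_mul, abs_of_nonneg (rowKernel_nonneg (weight_pos hlam)
        (mass_add_four_le hz hlam θ) t m o.2)])
    (fun θ hθ => (hasSum_rowKernel_green hz hlam hθ m o.2).mul_left _) hi
    (fun θ hθ => (hasSum_rowKernel_green hz hlam hθ m o.2).mul_left _)
  refine hasSum_of_eq (main.mul_left (1 / Real.pi)) (fun t => ?_) ?_
  · rw [lazyProb_eq hz hlam, lazyProb_eq hz hlam, cosCoeff, cosCoeff, ← mul_sub,
      ← integral_sub (integrableOn_cos_mul (hk t) _) (integrableOn_cos_mul (hk t) _)]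
    simp only [sub_mul]
  · rw [div_eq_inv_mul, mul_assoc, ← integral_const_mul, one_div]
    congr 2
    ext θ
    ring

theorem hasSum_lazyProb_sub_horizontal {z lam : ℝ} (hz : 0 < z) (hlam : 0 < lam) (u m : ℤ)
    (o : Vertex) :
    HasSum (fun t => lazyProb z lam t (u, m) o - lazyProb z lam t (u + 2, m) o)
      (2 * weight lam o.2 / Real.pi * ∫ θ in Set.Ioo 0 Real.pi,
        (Real.cos ((u - o.1 : ℤ) * θ) - Real.cos ((u - o.1 + 2 : ℤ) * θ))
          * green z lam θ m o.2) := by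
  rw [show u - o.1 + 2 = u + 2 - o.1 by ring]
  refine hasSum_lazyProb_sub_row hz hlam u (u + 2) m o ?_
  have hd := continuous_decay
  have hr := continuousOn_refl hz hlam
  have hg := contDiff_inv_four_mul_sqrt.continuous
  have hc : ContinuousOn (fun θ => |2 * Real.sin (((u - o.1 : ℤ) + 1) * θ)|
      * (2 * weight lam o.2 * (decay θ ^ (m - o.2).natAbs * (4 * √(1 + Real.sin θ ^ 2))⁻¹
        - decay θ ^ (m.natAbs + o.2.natAbs)
          * (refl z lam θ * (4 * √(1 + Real.sin θ ^ 2))⁻¹)))) (Set.Icc 0 Real.pi) := by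
    have aux : ∀ p : ℝ → ℝ, Continuous p →
        ContinuousOn (fun θ => |2 * Real.sin (((u - o.1 : ℤ) + 1) * θ)|
          * (2 * weight lam o.2 * (decay θ ^ (m - o.2).natAbs * p θ
            - decay θ ^ (m.natAbs + o.2.natAbs) * (refl z lam θ * p θ)))) (Set.Icc 0 Real.pi) :=
      fun p hp => by fun_prop
    exact aux _ hg
  refine (integrableOn_Ioo_of_continuousOn hc).congr_fun (fun θ hθ => ?_) measurableSet_Ioo
  have e := sin_mul_green (z := z) (lam := lam) hθ m o.2
  have e2 := cos_sub_cos_add_two (u - o.1 : ℤ) θ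
  dsimp only
  rw [show ((u + 2 - o.1 : ℤ) : ℝ) = (u - o.1 : ℤ) + 2 by push_cast; ring, e2, ← e,
    abs_mul _ (Real.sin θ), abs_of_pos (Real.sin_pos_of_mem_Ioo hθ)]
  ring

/-- A unit step changes the class and yields only a factor sin (θ/2), which suffices in row 0 by
`green_bottom`. -/
theorem summable_lazyProb_sub_bottom {z lam : ℝ} (hz : 0 < z) (hlam : 0 < lam) (u : ℤ)
    (o : Vertex) :
    Summable fun t => lazyProb z lam t (u, 0) o - lazyProb z lam t (u + 1, 0) o := by
  refine (hasSum_lazyProb_sub_row hz hlam u (u + 1) 0 o ?_).summable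
  have hd := continuous_decay
  have hr := continuous_reflDen hz lam
  have hc : ContinuousOn (fun θ => |2 * Real.sin (((u - o.1 : ℤ) + 1 / 2) * θ)|
      * (2 * weight lam o.2 * (decay θ ^ o.2.natAbs / reflDen z lam θ))) (Set.Icc 0 Real.pi) := by
    have h1 : ContinuousOn (fun θ => decay θ ^ o.2.natAbs / reflDen z lam θ)
        (Set.Icc 0 Real.pi) :=
      (hd.pow _).continuousOn.div hr.continuousOn fun θ hθ => (reflDen_pos hz hlam hθ).ne'
    fun_prop
  refine (integrableOn_Ioo_of_continuousOn hc).congr_fun (fun θ hθ => ?_) measurableSet_Ioo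
  have e2 : Real.cos ((u - o.1 : ℤ) * θ) - Real.cos ((u + 1 - o.1 : ℤ) * θ)
      = 2 * Real.sin (((u - o.1 : ℤ) + 1 / 2) * θ) * Real.sin (θ / 2) := by
    rw [Real.cos_sub_cos, show (((u - o.1 : ℤ) : ℝ) * θ + (u + 1 - o.1 : ℤ) * θ) / 2
        = ((u - o.1 : ℤ) + 1 / 2) * θ by push_cast; ring,
      show (((u - o.1 : ℤ) : ℝ) * θ - (u + 1 - o.1 : ℤ) * θ) / 2 = -(θ / 2) by push_cast; ring,
      Real.sin_neg]
    ring
  dsimp only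
  rw [e2, ← green_bottom hz hlam hθ, abs_mul _ (Real.sin (θ / 2)),
    abs_of_pos (sin_half_pos ⟨hθ.1, hθ.2.le⟩)]
  ring

theorem integrableOn_inv_sqrt_sin :
    IntegrableOn (fun θ => (√(Real.sin θ))⁻¹) (Set.Ioo 0 Real.pi) := by
  have hpi := Real.pi_pos
  have h1 : IntervalIntegrable (fun θ : ℝ => θ ^ (-(1 / 2) : ℝ)) volume 0 Real.pi :=
    intervalIntegral.intervalIntegrable_rpow' (by norm_num)
  have h2 : IntervalIntegrable (fun θ : ℝ => (Real.pi - θ) ^ (-(1 / 2) : ℝ)) volume 0 Real.pi := by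
    have := h1.comp_sub_left Real.pi
    simpa using this.symm
  have h3 := ((h1.add h2).const_mul 2)
  rw [intervalIntegrable_iff_integrableOn_Ioo_of_le hpi.le] at h3
  refine Integrable.mono' h3 (by fun_prop : Measurable _).aestronglyMeasurable ?_
  refine (ae_restrict_mem measurableSet_Ioo).mono fun θ hθ => ?_
  have hs := Real.sin_pos_of_mem_Ioo hθ
  have key : ∀ y : ℝ, 0 < y → y / 2 ≤ Real.sin θ → (√(Real.sin θ))⁻¹ ≤ 2 * y ^ (-(1 / 2) : ℝ) := by
    intro y hy hle
    rw [Real.rpow_neg hy.le, ← Real.sqrt_eq_rpow]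
    have e : √y / 2 ≤ √(Real.sin θ) := by
      rw [← Real.sqrt_sq (by norm_num : (0 : ℝ) ≤ 2), ← Real.sqrt_div hy.le]
      exact Real.sqrt_le_sqrt (by linarith)
    have hy' := Real.sqrt_pos.mpr hy
    calc (√(Real.sin θ))⁻¹ ≤ (√y / 2)⁻¹ := inv_anti₀ (by positivity) e
      _ = _ := by rw [inv_div]; ring
  rw [Real.norm_eq_abs, abs_of_pos (by positivity)]
  have p1 := Real.rpow_nonneg hθ.1.le (-(1 / 2) : ℝ)
  have p2 := Real.rpow_nonneg (sub_pos.mpr hθ.2).le (-(1 / 2) : ℝ)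
  rcases half_min_le_sin ⟨hθ.1.le, hθ.2.le⟩ with h | h
  · have := key θ hθ.1 h
    linarith
  · have := key (Real.pi - θ) (sub_pos.mpr hθ.2) h
    linarith

theorem hasSum_dipoleForm {z lam θ : ℝ} (hz : 0 < z) (hlam : 0 < lam)
    (hθ : θ ∈ Set.Ioo 0 Real.pi) (m m' : ℤ) :
    HasSum (fun t => dipoleForm (weight lam) (mass z lam θ) t m m')
      (2 * (green z lam θ m m + green z lam θ m' m' - green z lam θ m m'
        - green z lam θ m' m)) := by
  have h := fun m n => hasSum_rowKernel_green hz hlam hθ m n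
  have hm := (weight_pos hlam m).ne'
  have hm' := (weight_pos hlam m').ne'
  have := ((((h m m).div_const (weight lam m)).add ((h m' m').div_const (weight lam m'))).sub
    ((h m m').div_const (weight lam m'))).sub ((h m' m).div_const (weight lam m))
  refine hasSum_of_eq this (fun t => rfl) ?_
  field_simp

/-- The difference of two kernels has no sign, so Cauchy-Schwarz supplies the majorant. The diagonal
Green function is O(1 / sin θ) and the dipole energy is bounded; the weight ε = √(sin θ) makes both
contributions O((sin θ)^(-1/2)), which is integrable. -/
theorem hasSum_lazyProb_sub_vertical {z lam : ℝ} (hz : 0 < z) (hlam : 0 < lam) (u m : ℤ)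
    (o : Vertex) :
    HasSum (fun t => lazyProb z lam t (u, m) o - lazyProb z lam t (u, m + 1) o)
      (2 * weight lam o.2 / Real.pi * ∫ θ in Set.Ioo 0 Real.pi,
        Real.cos ((u - o.1 : ℤ) * θ)
          * (green z lam θ m o.2 - green z lam θ (m + 1) o.2)) := by
  have hk := fun t m => continuous_rowKernel (lam := lam) hz t m o.2
  have hd := continuous_decay
  have hr := continuousOn_refl hz hlam
  have hg := contDiff_inv_four_mul_sqrt.continuous
  have hv := contDiff_decay_div.continuous
  set n := o.2 with hn
  have hint : IntegrableOn (fun θ => (√(Real.sin θ) * (weight lam n *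
      (2 * weight lam n * green z lam θ n n)) + (√(Real.sin θ))⁻¹ *
      (2 * (green z lam θ m m + green z lam θ (m + 1) (m + 1) - green z lam θ m (m + 1)
        - green z lam θ (m + 1) m))) / 2) (Set.Ioo 0 Real.pi) := by
    have hc : ContinuousOn (fun θ => weight lam n ^ 2
        * (decay θ ^ (n - n).natAbs * (4 * √(1 + Real.sin θ ^ 2))⁻¹
          - decay θ ^ (n.natAbs + n.natAbs) * (refl z lam θ * (4 * √(1 + Real.sin θ ^ 2))⁻¹))
        + decay θ / (1 + decay θ) * (2 - (decay θ ^ (min m.natAbs (m + 1).natAbs)) ^ 2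
          * (1 - decay θ) * refl z lam θ)) (Set.Icc 0 Real.pi) := by
      have aux : ∀ p q : ℝ → ℝ, Continuous p → Continuous q → ContinuousOn (fun θ =>
          weight lam n ^ 2 * (decay θ ^ (n - n).natAbs * p θ
            - decay θ ^ (n.natAbs + n.natAbs) * (refl z lam θ * p θ))
          + q θ * (2 - (decay θ ^ (min m.natAbs (m + 1).natAbs)) ^ 2
            * (1 - decay θ) * refl z lam θ)) (Set.Icc 0 Real.pi) :=
        fun p q hp hq => by fun_prop
      exact aux _ _ hg hv
    have := IntegrableOn.continuousOn_mul_of_subset hc integrableOn_inv_sqrt_sin isCompact_Icc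
      measurableSet_Ioo Set.Ioo_subset_Icc_self
    refine this.congr_fun (fun θ hθ => ?_) measurableSet_Ioo
    have hs := Real.sin_pos_of_mem_Ioo hθ
    have hq := Real.sq_sqrt hs.le
    have hq0 := (Real.sqrt_pos.mpr hs).ne'
    dsimp only
    rw [green_dipole hθ, ← sin_mul_green hθ]
    field_simp
    rw [hq]
    ring
  have main := hasSum_integral_Ioo (ι := ℕ)
    (F := fun t θ => Real.cos ((u - o.1 : ℤ) * θ)
      * (rowKernel (weight lam) (mass z lam θ) t m n
        - rowKernel (weight lam) (mass z lam θ) t (m + 1) n))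
    (f := fun θ => Real.cos ((u - o.1 : ℤ) * θ)
      * (2 * weight lam n * green z lam θ m n - 2 * weight lam n * green z lam θ (m + 1) n))
    (fun t θ => (√(Real.sin θ) * (weight lam n * rowKernel (weight lam) (mass z lam θ) t n n)
      + (√(Real.sin θ))⁻¹ * dipoleForm (weight lam) (mass z lam θ) t m (m + 1)) / 2)
    (fun t => by
      have h1 := hk t m
      have h2 := hk t (m + 1)
      exact (by fun_prop : Continuous _).measurable)
    (fun t θ hθ => by
      rw [abs_mul]
      refine (mul_le_of_le_one_left (abs_nonneg _) (Real.abs_cos_le_one _)).trans ?_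
      exact abs_rowKernel_sub_le (weight_pos hlam) (mass_add_four_le hz hlam θ) t m (m + 1) n
        (Real.sqrt_pos.mpr (Real.sin_pos_of_mem_Ioo hθ)))
    (fun θ hθ => ((((hasSum_rowKernel_green hz hlam hθ n n).mul_left (weight lam n)).mul_left
      _).add ((hasSum_dipoleForm hz hlam hθ m (m + 1)).mul_left _)).div_const 2)
    hint
    (fun θ hθ => ((hasSum_rowKernel_green hz hlam hθ m n).sub
      (hasSum_rowKernel_green hz hlam hθ (m + 1) n)).mul_left _)
  refine hasSum_of_eq (main.mul_left (1 / Real.pi)) (fun t => ?_) ?_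
  · rw [lazyProb_eq hz hlam, lazyProb_eq hz hlam, cosCoeff, cosCoeff, ← mul_sub,
      ← integral_sub (integrableOn_cos_mul (hk t m) _) (integrableOn_cos_mul (hk t (m + 1)) _)]
    simp only [mul_sub, hn]
  · rw [div_eq_inv_mul, mul_assoc, ← integral_const_mul, one_div]
    congr 2
    ext θ
    ring

/-! ### The potential kernel -/

/-- Any two vertices are joined by vertical steps to row 0 and unit steps along it. This ensures
that the sums in `potentialKernel` are genuine and not the default value 0. -/
theorem summable_lazyProb_sub {z lam : ℝ} (hz : 0 < z) (hlam : 0 < lam) (x y o : Vertex) :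
    Summable fun t => lazyProb z lam t x o - lazyProb z lam t y o := by
  have trans : ∀ a b c : Vertex, Summable (fun t => lazyProb z lam t a o - lazyProb z lam t b o) →
      Summable (fun t => lazyProb z lam t b o - lazyProb z lam t c o) →
      Summable (fun t => lazyProb z lam t a o - lazyProb z lam t c o) := fun a b c h1 h2 =>
    (h1.add h2).congr fun t => by ring
  have symm : ∀ a b : Vertex, Summable (fun t => lazyProb z lam t a o - lazyProb z lam t b o) →
      Summable (fun t => lazyProb z lam t b o - lazyProb z lam t a o) := fun a b h =>
    h.neg.congr fun t => by ring
  have refl' : ∀ a : Vertex, Summable (fun t => lazyProb z lam t a o - lazyProb z lam t a o) :=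
    fun a => by simp
  have vert : ∀ u m : ℤ, Summable fun t => lazyProb z lam t (u, m) o - lazyProb z lam t (u, 0) o := by
    intro u m
    induction m using Int.induction_on with
    | zero => exact refl' _
    | succ k ih =>
      exact trans _ _ _ (symm _ _ (hasSum_lazyProb_sub_vertical hz hlam u k o).summable) ih
    | pred k ih =>
      have := (hasSum_lazyProb_sub_vertical hz hlam u (-k - 1) o).summable
      rw [sub_add_cancel] at this
      exact trans _ _ _ this ih
  have bottom : ∀ u : ℤ, Summable fun t => lazyProb z lam t (u, 0) o - lazyProb z lam t (0, 0) o := by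
    intro u
    induction u using Int.induction_on with
    | zero => exact refl' _
    | succ k ih => exact trans _ _ _ (symm _ _ (summable_lazyProb_sub_bottom hz hlam k o)) ih
    | pred k ih =>
      have := summable_lazyProb_sub_bottom hz hlam (-k - 1) o
      rw [sub_add_cancel] at this
      exact trans _ _ _ this ih
  have all : ∀ a : Vertex, Summable fun t => lazyProb z lam t a o - lazyProb z lam t (0, 0) o :=
    fun a => trans _ _ _ (vert a.1 a.2) (bottom a.1)
  exact trans _ _ _ (all x) (symm _ _ (all y))

theorem hasSum_lazyProb_sub {z lam : ℝ} (hz : 0 < z) (hlam : 0 < lam) (x x' o : Vertex) :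
    HasSum (fun t => lazyProb z lam t x o - lazyProb z lam t x' o)
      (-(potentialKernel z lam x o - potentialKernel z lam x' o)) := by
  have h := (summable_lazyProb_sub hz hlam x o o).hasSum.sub
    (summable_lazyProb_sub hz hlam x' o o).hasSum
  refine hasSum_of_eq h (fun t => ?_) ?_
  · ring
  · simp only [potentialKernel]; ring

theorem weight_le {lam : ℝ} (hlam : 0 < lam) (m : ℤ) : weight lam m ≤ 4 + 3 * lam := by
  unfold weight; split_ifs <;> linarith

theorem exists_gradient_bound {z lam : ℝ} (hz : 0 < z) (hlam : 0 < lam) :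
    ∃ C : ℝ, 0 < C ∧ ∀ o x x' : Vertex, SameClass x x' → dist x x' = 2 →
      |potentialKernel z lam x o - potentialKernel z lam x' o| * dist o x ≤ C := by
  obtain ⟨C, hC, hH⟩ := exists_horizontal_bound hz hlam
  obtain ⟨D, hD, hV⟩ := exists_vertical_bound hz hlam
  have hpi := Real.pi_pos
  set A := 2 * (4 + 3 * lam) / Real.pi
  have hA : 0 < A := by positivity
  -- The oscillatory bound is in terms of K, which uses row differences and a shifted or minimal
  -- argument; `R ≤ 2 * K` absorbs the row spacing 2 and these shifts.
  have scale : ∀ (o x x' : Vertex) (I B K : ℝ) (R : ℕ),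
      HasSum (fun t => lazyProb z lam t x o - lazyProb z lam t x' o)
        (2 * weight lam o.2 / Real.pi * I) → |I| * K ≤ B → (R : ℝ) ≤ 2 * K →
      |potentialKernel z lam x o - potentialKernel z lam x' o| * R ≤ 2 * A * B := by
    intro o x x' I B K R hs hI hR
    have e := (hasSum_lazyProb_sub hz hlam x x' o).unique hs
    have hW := weight_pos hlam o.2
    have hWA : 2 * weight lam o.2 / Real.pi ≤ A :=
      div_le_div_of_nonneg_right (by linarith [weight_le hlam o.2]) hpi.le
    rw [← abs_neg, e, abs_mul, abs_of_pos (by positivity)]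
    have hK : 0 ≤ K := by
      have : (0 : ℝ) ≤ R := Nat.cast_nonneg R
      linarith
    calc _ ≤ A * |I| * (2 * K) := by gcongr
      _ = 2 * A * (|I| * K) := by ring
      _ ≤ _ := by gcongr
  have horiz : ∀ (o : Vertex) (u m : ℤ) (R : ℕ),
      R ≤ 2 * (1 + (u - o.1 + 1).natAbs + (m - o.2).natAbs) →
      |potentialKernel z lam (u, m) o - potentialKernel z lam (u + 2, m) o| * R
        ≤ 2 * A * C := fun o u m R hR =>
    scale o _ _ _ _ _ R (hasSum_lazyProb_sub_horizontal hz hlam u m o) (hH (u - o.1) m o.2) (by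
      rw [← Int.cast_abs, Int.abs_eq_natAbs, Int.cast_natCast]
      exact_mod_cast hR)
  have vert : ∀ (o : Vertex) (u m : ℤ) (R : ℕ),
      R ≤ 2 * (1 + (u - o.1).natAbs + min (m - o.2).natAbs (m - o.2 + 1).natAbs) →
      |potentialKernel z lam (u, m) o - potentialKernel z lam (u, m + 1) o| * R
        ≤ 2 * A * D := fun o u m R hR =>
    scale o _ _ _ _ _ R (hasSum_lazyProb_sub_vertical hz hlam u m o) (hV (u - o.1) m o.2) (by
      rw [← Int.cast_abs, Int.abs_eq_natAbs, Int.cast_natCast]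
      exact_mod_cast hR)
  refine ⟨2 * A * C + 2 * A * D, by positivity, ?_⟩
  rintro o ⟨u, m⟩ ⟨v, l⟩ ⟨k, hk⟩ hdist
  have hAC : 0 ≤ 2 * A * C := by positivity
  have hAD : 0 ≤ 2 * A * D := by positivity
  simp only [dist] at hk hdist ⊢
  obtain ⟨rfl, rfl⟩ | ⟨rfl, rfl⟩ | ⟨rfl, rfl⟩ | ⟨rfl, rfl⟩ :
      (v = u + 2 ∧ l = m) ∨ (u = v + 2 ∧ l = m) ∨ (v = u ∧ l = m + 1) ∨ (v = u ∧ m = l + 1) := by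
    omega
  · exact (horiz o u l _ (by omega)).trans (by linarith)
  · rw [abs_sub_comm]
    exact (horiz o v l _ (by omega)).trans (by linarith)
  · exact (vert o v m _ (by omega)).trans (by linarith)
  · rw [abs_sub_comm]
    exact (vert o v l _ (by omega)).trans (by linarith)

end EffectiveWalk

/-! ### The bound with the logarithm -/

theorem proposition3p4 (z : ℝ) (hz : 0 < z) (lam : ℝ) (hlam : 0 < lam)
    (c : ℝ) (hc : 6 < c) :
    ∃ C : ℝ, 0 < C ∧ ∀ (o x x' : EffectiveWalk.Vertex) (R : ℕ), 2 ≤ R →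
      EffectiveWalk.dist o x = R →
      EffectiveWalk.SameClass x x' →
      EffectiveWalk.dist x x' = 2 →
      HasSum
          (fun t : ℕ => EffectiveWalk.lazyProb z lam t x o - EffectiveWalk.lazyProb z lam t x' o)
          (-(EffectiveWalk.potentialKernel z lam x o - EffectiveWalk.potentialKernel z lam x' o)) ∧
        |EffectiveWalk.potentialKernel z lam x o - EffectiveWalk.potentialKernel z lam x' o| ≤
          C * (Real.log R) ^ c / R := by
  obtain ⟨C, hC, hb⟩ := EffectiveWalk.exists_gradient_bound hz hlam
  have hlog2 : 0 < Real.log 2 := Real.log_pos one_lt_two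
  have hL : 0 < Real.log 2 ^ c := Real.rpow_pos_of_pos hlog2 c
  -- As R ≥ 2, the ratio (log R)^c / (log 2)^c is at least 1, so the bound C / R suffices.
  refine ⟨C / Real.log 2 ^ c, div_pos hC hL, fun o x x' R hR hd hs h2 =>
    ⟨EffectiveWalk.hasSum_lazyProb_sub hz hlam x x' o, ?_⟩⟩
  have hR2 : (2 : ℝ) ≤ R := by exact_mod_cast hR
  have hR0 : (0 : ℝ) < R := by linarith
  rw [le_div_iff₀ hR0, ← hd]
  refine (hb o x x' hs h2).trans ?_
  rw [hd, div_mul_eq_mul_div, le_div_iff₀ hL]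
  exact mul_le_mul_of_nonneg_left (Real.rpow_le_rpow hlog2.le
    (Real.log_le_log two_pos hR2) (by linarith)) hC.le
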